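/- Let \(\Lambda=\mathbb C\setminus[1,+\infty)\) and \(\mathbb H=\{z\in\mathbb C:\operatorname{Im}z>0\}\). Let \(\mathcal T\) be the set of analytic functions \(F\) on \(\Lambda\) of the form \[ F(z)=\int_0^1\frac{d\mu(t)}{1-tz},\qquad z\in\Lambda, \tag{$*$} \] for some Borel probability measure \(\mu\) on \([0,1]\). Let \(F\) be an analytic function on \(\Lambda\) with \(F(0)=1\), and suppose that the restriction of \(F\) to \(\mathbb H\) extends analytically across the slit \((1,+\infty)\) to a function \(F^+\); that is, \(F^+\) is analytic on some open set containing \(\mathbb H\cup(1,+\infty)\) and \(F^+=F\) on \(\mathbb H\). Suppose that the following five conditions hold: 1. \(F(x)\in\mathbb R\) for all \(x\in(-\infty,1)\); 2. \(\limsup_{x\to-\infty}F(x)\ge 0\) (the upper limit being taken in \([-\infty,+\infty]\)); 3. \(\operatorname{Im}F^+(x)\ge 0\) for all \(x\in(1,+\infty)\); 4. \(F(z)=O(|z|^{\alpha})\) as \(z\to\infty\) in \(\mathbb H\), for some real constant \(\alpha<1\); 5. \(F(z)=O(|z-1|^{-\alpha})\) as \(z\to1\) in \(\mathbb H\), for some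 real constant \(\alpha<1\) (not necessarily the same as in 4). Then \(F\in\mathcal T\). Moreover, the limits \[ \alpha_0=\lim_{x\to-\infty}F(x)\qquad\text{and}\qquad \alpha_1=\lim_{x\to1^-}(1-x)F(x) \] exist and are finite and non-negative, and \((*)\) holds for the Borel probability measure \(\mu\) on \([0,1]\) given by \[ d\mu(t)=\alpha_0\,d\delta_0(t)+\alpha_1\,d\delta_1(t)+\frac{\operatorname{Im}F^+(1/t)}{\pi t}\,dt , \] where \(\delta_0\) and \(\delta_1\) are the unit point masses at \(0\) and \(1\), and \(dt\) is Lebesgue measure on \((0,1)\). -/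

import Mathlib

open Set Filter Topology MeasureTheory Asymptotics

noncomputable section

/-- The slit domain `Λ = ℂ ∖ [1, +∞)`. -/
def slitDomain : Set ℂ := ((fun x : ℝ => (x : ℂ)) '' Set.Ici 1)ᶜ

/-- The open upper half-plane `ℍ = {z : 0 < Im z}`, as a set of complex numbers. -/
def upperHalf : Set ℂ := {z : ℂ | 0 < z.im}

/-- `μ` is a Borel probability measure on `[0, 1]` (regarded as a measure on `ℝ` giving no mass to
the complement of `[0, 1]`) and `F z = ∫ dμ(t) / (1 - t z)` for every `z ∈ Λ`. For such `z` the
integrand is bounded and continuous on `[0, 1]`, hence integrable. -/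
structure IsRepresentingMeasure (μ : Measure ℝ) (F : ℂ → ℂ) : Prop where
  isProbabilityMeasure : IsProbabilityMeasure μ
  compl_Icc_eq_zero : μ (Set.Icc (0 : ℝ) 1)ᶜ = 0
  eq_integral : ∀ z ∈ slitDomain, F z = ∫ t in Set.Icc (0 : ℝ) 1, 1 / (1 - (t : ℂ) * z) ∂μ

/-- The class `𝒯` of analytic functions on `Λ` that have a representing probability measure on
`[0, 1]`. Only the values on `Λ` of a function `F : ℂ → ℂ` matter. -/
def classT : Set (ℂ → ℂ) :=
  {F | AnalyticOnNhd ℂ F slitDomain ∧ ∃ μ : Measure ℝ, IsRepresentingMeasure μ F}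

/-- The measure `α₀ δ₀ + α₁ δ₁ + (Im G(1/t) / (π t)) dt` on `[0, 1]`, where `dt` is Lebesgue measure
on `(0, 1)`. It is used for `α₀, α₁ ≥ 0` and `Im G ≥ 0` on `(1, +∞)`. -/
def slitMeasure (α₀ α₁ : ℝ) (G : ℂ → ℂ) : Measure ℝ :=
  ENNReal.ofReal α₀ • Measure.dirac (0 : ℝ) + ENNReal.ofReal α₁ • Measure.dirac (1 : ℝ)
    + (volume.restrict (Set.Ioo (0 : ℝ) 1)).withDensity
        (fun t : ℝ => ENNReal.ofReal ((G ((1 / t : ℝ) : ℂ)).im / (Real.pi * t)))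

end

/-! The proof applies Schwarz's formula to h(z) = (F(z) - 1)/z, which is `dslope F 0`. Division by z
turns condition 4 into decay of a positive power at infinity. Condition 5 makes the singularity at 1
integrable, and h is locally bounded near every other point of the closed half-plane. So h is
recovered from the imaginary part of its boundary values (`eq_integral_im_boundary`). That part
vanishes on (-∞, 1) by condition 1 and equals Im F⁺(x)/x on (1, ∞).

With x = 1/t and d(t) = Im F⁺(1/t)/π ≥ 0 this reads h(z) = ∫₀¹ d(t)/(1 - tz) dt on ℍ, hence F(z) = 1
+ z ∫₀¹ d(t)/(1 - tz) dt on all of Λ by the identity theorem.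

It remains to show that d(t)/t is integrable. By the formula and d ≥ 0, F is increasing on (-∞, 0],
so condition 2 forces F ≥ 0 there. Thus ∫ (-x)d(t)/(1 - tx) dt ≤ 1 for x ≤ 0, and Fatou's lemma as x
→ -∞ gives ∫ d(t)/t dt ≤ 1. Dominated convergence then identifies α₀ = 1 - ∫ d(t)/t dt. Finally
zd/(1 - tz) = (d/t)/(1 - tz) - d/t turns the formula for F into the representation. Condition 5
forces α₁ = 0. -/

/-! ### Growth bounds on the upper half-plane -/

/-- A big-O bound on a set can be checked locally and at infinity. -/
theorem isBigO_principal_of_forall_nhdsWithin {X : Type*} [TopologicalSpace X] {S : Set X}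
    {f : X → ℂ} {g : X → ℝ} (hinf : f =O[cocompact X ⊓ 𝓟 S] g)
    (hloc : ∀ p, f =O[𝓝[S] p] g) : f =O[𝓟 S] g := by
  obtain ⟨c, hc⟩ := hinf.bound
  rw [eventually_inf_principal, Filter.Eventually, mem_cocompact] at hc
  obtain ⟨K, hK, hKc⟩ := hc
  have h1 : f =O[𝓟 (K ∩ S)] g := by
    refine hK.induction_on (p := fun t => f =O[𝓟 (t ∩ S)] g) ?_ ?_ ?_ ?_
    · simp
    · intro s t hst ht
      exact ht.mono (principal_mono.2 (inter_subset_inter_left _ hst))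
    · intro s t hs ht
      rw [union_inter_distrib_right, ← sup_principal]
      exact hs.sup ht
    · intro x _
      obtain ⟨c, hc⟩ := (hloc x).bound
      rw [eventually_nhdsWithin_iff] at hc
      refine ⟨_, mem_nhdsWithin_of_mem_nhds hc, ?_⟩
      exact isBigO_principal.2 ⟨c, fun y hy => hy.1 hy.2⟩
  have h2 : f =O[𝓟 (Kᶜ ∩ S)] g := isBigO_principal.2 ⟨c, fun y hy => hKc hy.1 hy.2⟩
  have h3 := h1.sup h2
  rw [sup_principal] at h3
  refine h3.mono (principal_mono.2 fun x hx => ?_)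
  by_cases hxK : x ∈ K
  · exact Or.inl ⟨hxK, hx⟩
  · exact Or.inr ⟨hxK, hx⟩

/-- The weight `‖w - 1‖ ^ (-b) + (1 + ‖w‖) ^ (-s)`: a singularity at `1` and decay at infinity. -/
noncomputable def growthWeight (b s : ℝ) (w : ℂ) : ℝ := ‖w - 1‖ ^ (-b) + (1 + ‖w‖) ^ (-s)

theorem growthWeight_nonneg (b s : ℝ) (w : ℂ) : 0 ≤ growthWeight b s w := by
  unfold growthWeight; positivity

/-- Each summand of the weight handles one end: the first the point 1, the second infinity. Near any
other point the second summand is bounded below by a positive constant, so local boundedness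
suffices there. -/
theorem isBigO_growthWeight {h : ℂ → ℂ} {b s : ℝ}
    (hloc : ∀ p : ℂ, p ≠ 1 → h =O[𝓝[upperHalf] p] (fun _ => (1 : ℝ)))
    (hone : h =O[𝓝[upperHalf] 1] (fun w => ‖w - 1‖ ^ (-b)))
    (hinf : h =O[Bornology.cobounded ℂ ⊓ 𝓟 upperHalf] (fun w => ‖w‖ ^ (-s))) (hs : 0 ≤ s) :
    h =O[𝓟 upperHalf] growthWeight b s := by
  apply isBigO_principal_of_forall_nhdsWithin
  · rw [← Metric.cobounded_eq_cocompact]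
    refine hinf.trans ?_
    refine IsBigO.of_bound (2 ^ s) ?_
    have : ∀ᶠ w : ℂ in Bornology.cobounded ℂ ⊓ 𝓟 upperHalf, 1 ≤ ‖w‖ :=
      Filter.Eventually.filter_mono inf_le_left
        (tendsto_norm_cobounded_atTop.eventually (eventually_ge_atTop 1))
    filter_upwards [this] with w hw
    rw [Real.norm_of_nonneg (growthWeight_nonneg _ _ _), Real.norm_of_nonneg (by positivity)]
    have h1 : (2 * ‖w‖) ^ (-s) ≤ (1 + ‖w‖) ^ (-s) :=
      Real.rpow_le_rpow_of_nonpos (by positivity) (by linarith) (by linarith)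
    rw [Real.mul_rpow (by norm_num) (by positivity)] at h1
    have h2 : (1 + ‖w‖) ^ (-s) ≤ growthWeight b s w := by
      unfold growthWeight
      have : 0 ≤ ‖w - 1‖ ^ (-b) := by positivity
      linarith
    have h3 : (2:ℝ) ^ s * (2 ^ (-s) * ‖w‖ ^ (-s)) = ‖w‖ ^ (-s) := by
      rw [← mul_assoc, ← Real.rpow_add (by norm_num)]; simp
    rw [← h3]
    exact mul_le_mul_of_nonneg_left (h1.trans h2) (by positivity)
  · intro p
    by_cases hp : p = 1
    · subst hp
      refine hone.trans (IsBigO.of_bound 1 (Eventually.of_forall fun w => ?_))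
      rw [Real.norm_of_nonneg (growthWeight_nonneg _ _ _), Real.norm_of_nonneg (by positivity)]
      unfold growthWeight
      have : 0 ≤ (1 + ‖w‖) ^ (-s) := by positivity
      linarith
    · refine (hloc p hp).trans ?_
      have hc : ContinuousAt (fun w : ℂ => (1 + ‖w‖) ^ (-s)) p := by
        refine ContinuousAt.rpow_const (by fun_prop) (Or.inl (by positivity))
      have hpos : 0 < (1 + ‖p‖) ^ (-s) := by positivity
      have hev := hc.eventually (lt_mem_nhds (half_lt_self hpos))
      refine IsBigO.of_bound (((1 + ‖p‖) ^ (-s) / 2)⁻¹) ?_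
      filter_upwards [mem_nhdsWithin_of_mem_nhds hev] with w hw
      rw [Real.norm_of_nonneg (growthWeight_nonneg _ _ _), norm_one, inv_mul_eq_div, le_div_iff₀
        (by positivity), one_mul]
      have : 0 ≤ ‖w - 1‖ ^ (-b) := by positivity
      replace hw : (1 + ‖p‖) ^ (-s) / 2 < (1 + ‖w‖) ^ (-s) := hw
      unfold growthWeight
      linarith

/-! ### Cauchy's theorem with boundary values on the real line -/

/-- Cauchy's theorem on the upper half-plane, with integrable boundary values. -/
theorem integral_boundary_eq_zero {k : ℂ → ℂ} {κ : ℝ → ℂ} {g : ℝ → ℝ} {η : ℝ} (hη : 0 < η)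
    (hk : DifferentiableOn ℂ k upperHalf)
    (hdecay : k =o[Bornology.cobounded ℂ ⊓ 𝓟 upperHalf] (fun w => ‖w‖⁻¹))
    (hg : Integrable g)
    (hkg : ∀ᵐ x : ℝ, ∀ y ∈ Ioo 0 η, ‖k (x + y * Complex.I)‖ ≤ g x)
    (hlim : ∀ᵐ x : ℝ, Tendsto (fun y : ℝ => k (x + y * Complex.I)) (𝓝[>] 0) (𝓝 (κ x))) :
    ∫ x, κ x = 0 := by
  have hinv : Tendsto (fun n : ℝ => n⁻¹) atTop (𝓝[>] 0) := tendsto_inv_atTop_nhdsGT_zero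
  have hG0 : ∀ᶠ n : ℝ in atTop, n⁻¹ ∈ Ioo 0 η := hinv.eventually (Ioo_mem_nhdsGT hη)
  -- The contour is the boundary of [-n, n] × [1/n, n]. Its bottom side tends to the boundary
  -- integral by domination, while the other three sides tend to 0.
  have hlim1 : Tendsto (fun n : ℝ => ∫ x, (Ioc (-n) n).indicator
      (fun x : ℝ => k (x + (n⁻¹ : ℝ) * Complex.I)) x) atTop (𝓝 (∫ x, κ x)) := by
    refine tendsto_integral_filter_of_dominated_convergence g ?_ ?_ hg ?_
    · filter_upwards [hG0] with n hn
      have : ContinuousOn (fun x : ℝ => k (x + (n⁻¹ : ℝ) * Complex.I)) (Ioc (-n) n) := by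
        refine hk.continuousOn.comp (by fun_prop) fun x _ => ?_
        simpa [upperHalf] using hn.1
      rw [aestronglyMeasurable_indicator_iff measurableSet_Ioc]
      exact this.aestronglyMeasurable measurableSet_Ioc
    · filter_upwards [hG0] with n hn
      filter_upwards [hkg] with x hx
      have h0 := hx _ hn
      exact (norm_indicator_le_norm_self _ _).trans h0
    · filter_upwards [hlim] with x hx
      refine (hx.comp hinv).congr' ?_
      filter_upwards [eventually_gt_atTop |x|] with n hn
      rw [indicator_of_mem]
      · rfl
      · exact ⟨(abs_lt.1 hn).1, (abs_lt.1 hn).2.le⟩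
  have hlim2 : Tendsto (fun n : ℝ => ∫ x, (Ioc (-n) n).indicator
      (fun x : ℝ => k (x + (n⁻¹ : ℝ) * Complex.I)) x) atTop (𝓝 0) := by
    rw [Metric.tendsto_nhds]
    intro ε hε
    -- With ε/8 the top side, of length 2n, contributes at most ε/4 and each vertical side at most
    -- ε/8, for a total of ε/2.
    have hd := hdecay.def (show 0 < ε / 8 by positivity)
    rw [eventually_inf_principal, ← comap_norm_atTop, eventually_comap] at hd
    obtain ⟨R, hR⟩ := eventually_atTop.1 hd
    filter_upwards [eventually_ge_atTop R, eventually_gt_atTop 1] with n hnR hn1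
    have hn0 : 0 < n := by linarith
    have hni : n⁻¹ < 1 := inv_lt_one_of_one_lt₀ hn1
    have hnp : 0 < n⁻¹ := by positivity
    have hb : ∀ w : ℂ, 0 < w.im → n ≤ ‖w‖ → ‖k w‖ ≤ ε / 8 * n⁻¹ := by
      intro w hw hwn
      refine (hR ‖w‖ (hnR.trans hwn) w rfl hw).trans ?_
      rw [norm_inv, norm_norm]
      gcongr
    have hrect := Complex.integral_boundary_rect_eq_zero_of_differentiableOn k
      (⟨-n, n⁻¹⟩ : ℂ) (⟨n, n⟩ : ℂ) (hk.mono ?_)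
    · simp only at hrect
      have e1 : ‖∫ x : ℝ in (-n)..n, k (x + (n : ℝ) * Complex.I)‖ ≤ ε / 8 * n⁻¹ * |n - -n| := by
        refine intervalIntegral.norm_integral_le_of_norm_le_const fun x _ => ?_
        refine hb _ (by simpa using hn0) ?_
        refine le_trans ?_ (Complex.abs_im_le_norm _)
        simpa using le_abs_self n
      have e2 : ∀ a : ℝ, |a| = n →
          ‖∫ y : ℝ in n⁻¹..n, k ((a : ℝ) + y * Complex.I)‖ ≤ ε / 8 * n⁻¹ * |n - n⁻¹| := by
        intro a ha
        refine intervalIntegral.norm_integral_le_of_norm_le_const fun y hy => ?_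
        rw [uIoc_of_le (by linarith)] at hy
        refine hb _ (by simpa using hnp.trans hy.1) ?_
        refine le_trans ?_ (Complex.abs_re_le_norm _)
        simpa using ha.ge
      have e2a := e2 n (abs_of_pos hn0)
      have e2b := e2 (-n) (by rw [abs_neg, abs_of_pos hn0])
      rw [dist_zero_right, integral_indicator measurableSet_Ioc,
        ← intervalIntegral.integral_of_le (by linarith)]
      generalize (∫ x : ℝ in (-n)..n, k (x + (n⁻¹ : ℝ) * Complex.I)) = A at *
      generalize (∫ x : ℝ in (-n)..n, k (x + (n : ℝ) * Complex.I)) = B at *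
      generalize (∫ y : ℝ in n⁻¹..n, k ((n : ℝ) + y * Complex.I)) = C at *
      generalize (∫ y : ℝ in n⁻¹..n, k ((-n : ℝ) + y * Complex.I)) = D at *
      have hA : A = B - Complex.I * C + Complex.I * D := by
        simp only [smul_eq_mul] at hrect
        linear_combination hrect
      have hn2 : |n - -n| = 2 * n := by rw [abs_of_pos] <;> linarith
      have hn3 : |n - n⁻¹| ≤ n := by rw [abs_of_pos] <;> linarith
      have hB : ‖B‖ ≤ ε / 4 := by
        refine e1.trans (le_of_eq ?_)
        rw [hn2]; field_simp; ring
      have hCC : ε / 8 * n⁻¹ * |n - n⁻¹| ≤ ε / 8 := by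
        calc ε / 8 * n⁻¹ * |n - n⁻¹| ≤ ε / 8 * n⁻¹ * n := by gcongr
          _ = ε / 8 := by field_simp
      have hI : ∀ c : ℂ, ‖Complex.I * c‖ = ‖c‖ := by simp
      calc ‖A‖ ≤ ‖B‖ + ‖C‖ + ‖D‖ := by
            rw [hA]
            refine (norm_add_le _ _).trans ?_
            rw [hI]
            gcongr
            refine (norm_sub_le _ _).trans ?_
            rw [hI]
        _ < ε := by linarith
    · rintro w ⟨_, hw⟩
      simp only [mem_preimage] at hw
      rw [uIcc_of_le (by linarith)] at hw
      exact hnp.trans_le hw.1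
  exact tendsto_nhds_unique hlim1 hlim2

/-- The singularity has order b < 1, and the decay at infinity has order 1 + b > 1. The shift by c
costs a factor 1 + |c|. -/
theorem integrable_rpow_abs_sub_div {b : ℝ} (hb0 : 0 < b) (hb1 : b < 1) (c : ℝ) :
    Integrable (fun x : ℝ => |x - c| ^ (-b) * (1 + |x|)⁻¹) := by
  have h1 : IntegrableOn (fun u : ℝ => u ^ (-b) * (1 + u)⁻¹) (Ioi 0) := by
    have hm : ∀ s : Set ℝ, AEStronglyMeasurable (fun u : ℝ => u ^ (-b) * (1 + u)⁻¹)
        (volume.restrict s) := fun s => by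
      apply Measurable.aestronglyMeasurable; fun_prop
    rw [← Ioc_union_Ioi_eq_Ioi zero_le_one]
    refine IntegrableOn.union ?_ ?_
    · have := (intervalIntegral.intervalIntegrable_rpow' (a := 0) (b := 1) (r := -b)
        (by linarith)).1
      refine this.mono' (hm _) ?_
      filter_upwards [ae_restrict_mem measurableSet_Ioc] with u hu
      have hu0 := hu.1
      rw [Real.norm_of_nonneg (by positivity)]
      exact mul_le_of_le_one_right (by positivity) (inv_le_one_of_one_le₀ (by linarith))
    · have := integrableOn_Ioi_rpow_of_lt (a := -b - 1) (c := 1) (by linarith) one_pos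
      refine this.mono' (hm _) ?_
      filter_upwards [ae_restrict_mem measurableSet_Ioi] with u hu
      have hu0 : 0 < u := one_pos.trans hu
      rw [Real.norm_of_nonneg (by positivity), Real.rpow_sub hu0, Real.rpow_one, div_eq_mul_inv]
      gcongr
      linarith
  have h2 : Integrable (fun u : ℝ => |u| ^ (-b) * (1 + |u|)⁻¹) := by
    have := (integrable_fun_norm_addHaar (E := ℝ) volume
      (f := fun u : ℝ => u ^ (-b) * (1 + u)⁻¹)).2 (by simpa using h1)
    simpa using this
  refine ((h2.comp_sub_right c).const_mul (1 + |c|)).mono' ?_ (Eventually.of_forall fun x => ?_)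
  · apply Measurable.aestronglyMeasurable; fun_prop
  · rw [Real.norm_of_nonneg (by positivity), mul_left_comm]
    gcongr
    have h3 : 1 + |x - c| ≤ (1 + |c|) * (1 + |x|) := by
      have := abs_sub x c
      nlinarith [abs_nonneg x, abs_nonneg c]
    rw [← div_eq_mul_inv, inv_eq_one_div, div_le_div_iff₀ (by positivity) (by positivity)]
    linarith

open scoped ComplexConjugate

/-- The integrable majorant on the real line of `growthWeight b s w / (w - ζ)`. -/
noncomputable def lineWeight (b s x : ℝ) : ℝ := (|x - 1| ^ (-b) + (1 + |x|) ^ (-s)) * (1 + |x|)⁻¹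

theorem integrable_lineWeight {b s : ℝ} (hb0 : 0 < b) (hb1 : b < 1) (hs : 0 < s) :
    Integrable (lineWeight b s) := by
  have h1 := integrable_rpow_abs_sub_div hb0 hb1 1
  have h2 : Integrable (fun x : ℝ => (1 + |x|) ^ (-s) * (1 + |x|)⁻¹) := by
    have := integrable_one_add_norm (E := ℝ) (μ := volume) (r := s + 1) (by simpa using hs)
    refine this.congr (Eventually.of_forall fun x => ?_)
    simp only [Real.norm_eq_abs]
    rw [neg_add, Real.rpow_add (by positivity), Real.rpow_neg_one]
  refine (h1.add h2).congr (Eventually.of_forall fun x => ?_)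
  simp only [lineWeight, Pi.add_apply]
  ring

/-- In this strip w stays at distance at least |Im ζ|/2 from ζ, and that distance grows like |Re w|.
-/
theorem one_add_abs_re_le_mul_norm_sub {ζ : ℂ} (hζ : ζ.im ≠ 0) :
    ∃ K : ℝ, 0 < K ∧ ∀ w : ℂ, |w.im| ≤ |ζ.im| / 2 → 1 + |w.re| ≤ K * ‖w - ζ‖ := by
  have hpos : 0 < |ζ.im| / 2 := by positivity
  refine ⟨(1 + |ζ.re|) / (|ζ.im| / 2) + 1, by positivity, fun w hw => ?_⟩
  have h1 : |ζ.im| / 2 ≤ ‖w - ζ‖ := by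
    have h2 := Complex.abs_im_le_norm (w - ζ)
    rw [Complex.sub_im] at h2
    have h3 := abs_sub_abs_le_abs_sub ζ.im w.im
    rw [abs_sub_comm] at h3
    linarith
  have h4 : |w.re| ≤ |ζ.re| + ‖w - ζ‖ := by
    have h2 := Complex.abs_re_le_norm (w - ζ)
    rw [Complex.sub_re] at h2
    have h3 := abs_sub_abs_le_abs_sub w.re ζ.re
    linarith
  have h5 : 1 + |ζ.re| ≤ (1 + |ζ.re|) / (|ζ.im| / 2) * ‖w - ζ‖ := by
    rw [div_mul_eq_mul_div, le_div_iff₀ hpos]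
    gcongr
  linarith

/-- The majorant is uniform in the height y: negative powers only grow when w is replaced by its
real part. -/
theorem norm_div_sub_le_lineWeight {φ : ℂ → ℂ} {b s : ℝ} (hb : 0 ≤ b) (hs : 0 ≤ s)
    (hφ : φ =O[𝓟 upperHalf] growthWeight b s) {ζ : ℂ} (hζ : ζ.im ≠ 0) :
    ∃ C : ℝ, ∀ x : ℝ, x ≠ 1 → ∀ y ∈ Ioo 0 (|ζ.im| / 2),
      ‖φ (x + y * Complex.I) / (x + y * Complex.I - ζ)‖ ≤ C * lineWeight b s x := by
  obtain ⟨C, hC0, hC⟩ := hφ.exists_pos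
  rw [isBigOWith_principal] at hC
  obtain ⟨K, hK0, hK⟩ := one_add_abs_re_le_mul_norm_sub hζ
  refine ⟨C * K, fun x hx y hy => ?_⟩
  set w : ℂ := x + y * Complex.I with hw
  have hre : w.re = x := by simp [hw]
  have him : w.im = y := by simp [hw]
  have hwH : w ∈ upperHalf := by
    change 0 < w.im
    rw [him]; exact hy.1
  have h1 := hC w hwH
  rw [Real.norm_of_nonneg (growthWeight_nonneg _ _ _)] at h1
  have h2 := hK w (by rw [him, abs_of_pos hy.1]; exact hy.2.le)
  rw [hre] at h2
  have hx1 : 0 < |x - 1| := abs_pos.2 (sub_ne_zero.2 hx)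
  have h3 : growthWeight b s w ≤ |x - 1| ^ (-b) + (1 + |x|) ^ (-s) := by
    unfold growthWeight
    have e1 : |x - 1| ≤ ‖w - 1‖ := by
      simpa [hre] using Complex.abs_re_le_norm (w - 1)
    have e2 : |x| ≤ ‖w‖ := by simpa [hre] using Complex.abs_re_le_norm w
    exact add_le_add (Real.rpow_le_rpow_of_nonpos hx1 e1 (by linarith))
      (Real.rpow_le_rpow_of_nonpos (by positivity) (by linarith) (by linarith))
  have h4 : 0 < ‖w - ζ‖ := by
    have : 0 < K * ‖w - ζ‖ := lt_of_lt_of_le (by positivity) h2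
    exact pos_of_mul_pos_right this hK0.le
  have h5 : ‖w - ζ‖⁻¹ ≤ K * (1 + |x|)⁻¹ := by
    rw [← div_eq_mul_inv, inv_eq_one_div, div_le_div_iff₀ h4 (by positivity)]
    linarith
  rw [norm_div, div_eq_mul_inv]
  calc ‖φ w‖ * ‖w - ζ‖⁻¹ ≤ (C * (|x - 1| ^ (-b) + (1 + |x|) ^ (-s))) * (K * (1 + |x|)⁻¹) := by
        gcongr
        exact h1.trans (by gcongr)
    _ = C * K * lineWeight b s x := by unfold lineWeight; ring

theorem tendsto_growthWeight_cobounded {b s : ℝ} (hb : 0 < b) (hs : 0 < s) :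
    Tendsto (growthWeight b s) (Bornology.cobounded ℂ) (𝓝 0) := by
  have h1 : Tendsto (fun w : ℂ => ‖w - 1‖) (Bornology.cobounded ℂ) atTop := by
    refine tendsto_atTop_mono (f := fun w : ℂ => ‖w‖ - 1) (fun w => ?_)
      (tendsto_atTop_add_const_right _ (-1) tendsto_norm_cobounded_atTop)
    simpa using norm_sub_norm_le w 1
  have h2 : Tendsto (fun w : ℂ => 1 + ‖w‖) (Bornology.cobounded ℂ) atTop :=
    tendsto_atTop_add_const_left _ 1 tendsto_norm_cobounded_atTop
  have h3 := ((tendsto_rpow_neg_atTop hb).comp h1).add ((tendsto_rpow_neg_atTop hs).comp h2)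
  rw [add_zero] at h3
  exact h3

theorem isBigO_inv_sub_cobounded (ζ : ℂ) :
    (fun w : ℂ => (w - ζ)⁻¹) =O[Bornology.cobounded ℂ] (fun w => ‖w‖⁻¹) := by
  refine IsBigO.of_bound 2 ?_
  filter_upwards [tendsto_norm_cobounded_atTop.eventually (eventually_ge_atTop (2 * ‖ζ‖ + 1))]
    with w hw
  have hz := norm_nonneg ζ
  have h1 : ‖w‖ / 2 ≤ ‖w - ζ‖ := by
    have := norm_sub_norm_le w ζ
    linarith
  rw [norm_inv, norm_inv, norm_norm]
  calc ‖w - ζ‖⁻¹ ≤ (‖w‖ / 2)⁻¹ := inv_anti₀ (by linarith) h1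
    _ = 2 * ‖w‖⁻¹ := by rw [inv_div, div_eq_mul_inv]

/-- Keeping k separate from the quotient covers both positions of ζ: below the axis k is the
quotient itself, and in ℍ it is the quotient with a removable singularity filled in. -/
theorem integral_boundary_div_sub_eq_zero {φ k : ℂ → ℂ} {κ : ℝ → ℂ} {b s : ℝ}
    (hb0 : 0 < b) (hb1 : b < 1) (hs : 0 < s)
    (hφ : φ =O[𝓟 upperHalf] growthWeight b s) {ζ : ℂ} (hζ : ζ.im ≠ 0)
    (hk : DifferentiableOn ℂ k upperHalf) (hkφ : ∀ w ∈ upperHalf, w ≠ ζ → k w = φ w / (w - ζ))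
    (hlim : ∀ᵐ x : ℝ, Tendsto (fun y : ℝ => φ (x + y * Complex.I)) (𝓝[>] 0) (𝓝 (κ x))) :
    ∫ x : ℝ, κ x / (x - ζ) = 0 := by
  obtain ⟨C, hC⟩ := norm_div_sub_le_lineWeight hb0.le hs.le hφ hζ
  have hη : 0 < |ζ.im| / 2 := by positivity
  -- Heights below |Im ζ|/2 avoid ζ, so the value of k at ζ plays no role near the axis.
  have hkeq : ∀ x : ℝ, ∀ y ∈ Ioo 0 (|ζ.im| / 2), k (x + y * Complex.I) =
      φ (x + y * Complex.I) / (x + y * Complex.I - ζ) := by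
    intro x y hy
    refine hkφ _ (by simpa [upperHalf] using hy.1) fun h => ?_
    have h1 := congrArg Complex.im h
    simp at h1
    rw [h1] at hy
    have := hy.2
    rw [abs_of_pos hy.1] at this
    linarith [hy.1]
  refine integral_boundary_eq_zero hη hk ?_ ((integrable_lineWeight hb0 hb1 hs).const_mul C) ?_ ?_
  · have h1 : φ =o[Bornology.cobounded ℂ ⊓ 𝓟 upperHalf] (fun _ => (1 : ℝ)) := by
      refine (hφ.mono inf_le_right).trans_isLittleO ?_
      rw [isLittleO_one_iff]
      exact (tendsto_growthWeight_cobounded hb0 hs).mono_left inf_le_left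
    have h2 := h1.mul_isBigO ((isBigO_inv_sub_cobounded ζ).mono inf_le_left)
    simp only [one_mul] at h2
    refine h2.congr' ?_ EventuallyEq.rfl
    have h3 : ∀ᶠ w in Bornology.cobounded ℂ ⊓ 𝓟 upperHalf, w ≠ ζ := by
      refine Filter.Eventually.filter_mono inf_le_left ?_
      filter_upwards [tendsto_norm_cobounded_atTop.eventually (eventually_gt_atTop ‖ζ‖)] with w hw
      rintro rfl
      exact lt_irrefl _ hw
    filter_upwards [h3, mem_inf_of_right (mem_principal_self upperHalf)] with w hw hwH
    rw [hkφ w hwH hw, div_eq_mul_inv]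
  · filter_upwards [compl_mem_ae_iff.2 (measure_singleton (1 : ℝ))] with x hx y hy
    rw [hkeq x y hy]
    exact hC x hx y hy
  · filter_upwards [hlim] with x hx
    have hne : (x : ℂ) - ζ ≠ 0 := by
      intro h
      have := congrArg Complex.im h
      simp at this
      exact hζ this
    have h1 : Tendsto (fun y : ℝ => (x : ℂ) + y * Complex.I - ζ) (𝓝[>] 0) (𝓝 (x - ζ)) := by
      have : Continuous (fun y : ℝ => (x : ℂ) + y * Complex.I - ζ) := by fun_prop
      simpa using (this.tendsto 0).mono_left nhdsWithin_le_nhds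
    refine (hx.div h1 hne).congr' ?_
    filter_upwards [Ioo_mem_nhdsGT hη] with y hy
    exact (hkeq x y hy).symm

theorem aestronglyMeasurable_boundary {φ : ℂ → ℂ} {κ : ℝ → ℂ}
    (hd : ContinuousOn φ upperHalf)
    (hlim : ∀ᵐ x : ℝ, Tendsto (fun y : ℝ => φ (x + y * Complex.I)) (𝓝[>] 0) (𝓝 (κ x))) :
    AEStronglyMeasurable κ volume := by
  have hinv : Tendsto (fun n : ℝ => n⁻¹) atTop (𝓝[>] 0) := tendsto_inv_atTop_nhdsGT_zero
  have h2 : Tendsto (fun n : ℕ => ((n : ℝ) + 1)) atTop atTop :=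
    tendsto_atTop_add_const_right _ 1 tendsto_natCast_atTop_atTop
  refine aestronglyMeasurable_of_tendsto_ae atTop
    (f := fun (n : ℕ) (x : ℝ) => φ (x + (((n : ℝ) + 1)⁻¹ : ℝ) * Complex.I)) (fun n => ?_) ?_
  · refine Continuous.aestronglyMeasurable ?_
    refine hd.comp_continuous (by fun_prop) fun x => ?_
    have : (0 : ℝ) < ((n : ℝ) + 1)⁻¹ := by positivity
    change 0 < Complex.im _
    rw [Complex.add_im, Complex.im_ofReal_mul]
    simpa using this
  · filter_upwards [hlim] with x hx
    exact hx.comp (hinv.comp h2)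

theorem integrable_boundary_div_sub {φ : ℂ → ℂ} {κ : ℝ → ℂ} {b s : ℝ}
    (hb0 : 0 < b) (hb1 : b < 1) (hs : 0 < s) (hd : ContinuousOn φ upperHalf)
    (hφ : φ =O[𝓟 upperHalf] growthWeight b s) {ζ : ℂ} (hζ : ζ.im ≠ 0)
    (hlim : ∀ᵐ x : ℝ, Tendsto (fun y : ℝ => φ (x + y * Complex.I)) (𝓝[>] 0) (𝓝 (κ x))) :
    Integrable (fun x : ℝ => κ x / (x - ζ)) := by
  obtain ⟨C, hC⟩ := norm_div_sub_le_lineWeight hb0.le hs.le hφ hζ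
  have hη : 0 < |ζ.im| / 2 := by positivity
  refine ((integrable_lineWeight hb0 hb1 hs).const_mul C).mono' ?_ ?_
  · have hc : AEStronglyMeasurable (fun x : ℝ => ((x : ℂ) - ζ)⁻¹) volume :=
      Measurable.aestronglyMeasurable (by fun_prop)
    simp only [div_eq_mul_inv]
    exact (aestronglyMeasurable_boundary hd hlim).mul hc
  · filter_upwards [hlim, compl_mem_ae_iff.2 (measure_singleton (1 : ℝ))] with x hx hx1
    have hne : (x : ℂ) - ζ ≠ 0 := by
      intro h
      have := congrArg Complex.im h
      simp at this
      exact hζ this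
    have h1 : Tendsto (fun y : ℝ => (x : ℂ) + y * Complex.I - ζ) (𝓝[>] 0) (𝓝 (x - ζ)) := by
      have : Continuous (fun y : ℝ => (x : ℂ) + y * Complex.I - ζ) := by fun_prop
      simpa using (this.tendsto 0).mono_left nhdsWithin_le_nhds
    refine le_of_tendsto (hx.div h1 hne).norm ?_
    filter_upwards [Ioo_mem_nhdsGT hη] with y hy
    exact hC x hx1 y hy

/-! ### The Poisson kernel and the Schwarz formula -/

theorem integral_univ_inv_sq_add_sq (a : ℝ) {y : ℝ} (hy : 0 < y) :
    ∫ x : ℝ, ((x - a) ^ 2 + y ^ 2)⁻¹ = Real.pi / y := by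
  rw [integral_sub_right_eq_self (fun x : ℝ => (x ^ 2 + y ^ 2)⁻¹) a]
  have h := Measure.integral_comp_div (fun x : ℝ => (1 + x ^ 2)⁻¹) y
  rw [integral_univ_inv_one_add_sq, abs_of_pos hy, smul_eq_mul] at h
  have h2 : ∀ x : ℝ, (x ^ 2 + y ^ 2)⁻¹ = (y ^ 2)⁻¹ * (1 + (x / y) ^ 2)⁻¹ := by
    intro x
    rw [← mul_inv]
    congr 1
    field_simp
    ring
  simp_rw [h2]
  rw [integral_const_mul, h]
  field_simp

theorem integral_cauchy_kernel {z : ℂ} (hz : 0 < z.im) :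
    ∫ x : ℝ, (z - conj z) / ((x - conj z) * (x - z)) = 2 * Real.pi * Complex.I := by
  have h1 : ∀ x : ℝ, (z - conj z) / (((x : ℂ) - conj z) * (x - z)) =
      (z - conj z) * ((((x - z.re) ^ 2 + z.im ^ 2)⁻¹ : ℝ) : ℂ) := by
    intro x
    rw [div_eq_mul_inv, Complex.ofReal_inv]
    congr 2
    apply Complex.ext <;> simp [pow_two] <;> ring
  simp_rw [h1]
  rw [integral_const_mul, integral_complex_ofReal, integral_univ_inv_sq_add_sq _ hz,
    Complex.sub_conj]
  push_cast
  have : (z.im : ℂ) ≠ 0 := by exact_mod_cast hz.ne'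
  field_simp

theorem isBigO_inv_sub_conj_growthWeight {b s : ℝ} {z : ℂ} (hz : 0 < z.im) (hs1 : s ≤ 1) :
    (fun w : ℂ => (w - conj z)⁻¹) =O[𝓟 upperHalf] growthWeight b s := by
  rw [isBigO_principal]
  refine ⟨(1 + ‖z‖) / z.im + 1, fun w hw => ?_⟩
  have hw' : 0 < w.im := hw
  have h1 : z.im ≤ ‖w - conj z‖ := by
    have := (le_abs_self _).trans (Complex.abs_im_le_norm (w - conj z))
    simp only [Complex.sub_im, Complex.conj_im] at this
    linarith
  have h2 : ‖w‖ ≤ ‖w - conj z‖ + ‖z‖ := by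
    have := norm_sub_norm_le w (conj z)
    rw [Complex.norm_conj] at this
    linarith
  have h3 : 1 + ‖z‖ ≤ (1 + ‖z‖) / z.im * ‖w - conj z‖ := by
    rw [div_mul_eq_mul_div, le_div_iff₀ hz]
    gcongr
  have h4 : (1 + ‖w‖)⁻¹ ≤ growthWeight b s w := by
    rw [← Real.rpow_neg_one]
    have h5 : (1 + ‖w‖) ^ (-1 : ℝ) ≤ (1 + ‖w‖) ^ (-s) :=
      Real.rpow_le_rpow_of_exponent_le (by linarith [norm_nonneg w]) (by linarith)
    have h6 : 0 ≤ ‖w - 1‖ ^ (-b) := by positivity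
    unfold growthWeight
    linarith
  rw [Real.norm_of_nonneg (growthWeight_nonneg _ _ _), norm_inv]
  refine le_trans ?_ (mul_le_mul_of_nonneg_left h4 (by positivity))
  rw [← div_eq_mul_inv, inv_eq_one_div, div_le_div_iff₀ (hz.trans_le h1) (by positivity)]
  linarith

/-- The Schwarz integral formula in the upper half-plane: a holomorphic function vanishing at
infinity is recovered from the imaginary part of its boundary values. -/
theorem eq_integral_im_boundary {h : ℂ → ℂ} {κ : ℝ → ℂ} {b s : ℝ}
    (hb0 : 0 < b) (hb1 : b < 1) (hs : 0 < s) (hs1 : s ≤ 1)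
    (hd : DifferentiableOn ℂ h upperHalf)
    (hh : h =O[𝓟 upperHalf] growthWeight b s)
    (hlim : ∀ᵐ x : ℝ, Tendsto (fun y : ℝ => h (x + y * Complex.I)) (𝓝[>] 0) (𝓝 (κ x)))
    {z : ℂ} (hz : z ∈ upperHalf) :
    Integrable (fun x : ℝ => ((κ x).im : ℂ) / (x - z)) ∧
      Real.pi * h z = ∫ x : ℝ, ((κ x).im : ℂ) / (x - z) := by
  have hz' : 0 < z.im := hz
  have hopen : IsOpen upperHalf := isOpen_lt continuous_const Complex.continuous_im
  have hcz : (conj z).im ≠ 0 := by simpa using hz'.ne'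
  have hne : ∀ w ∈ upperHalf, w - conj z ≠ 0 := by
    intro w hw h0
    have h1 := congrArg Complex.im h0
    simp at h1
    have : 0 < w.im := hw
    linarith
  have hneR : ∀ x : ℝ, (x : ℂ) - conj z ≠ 0 := by
    intro x h0
    have h1 := congrArg Complex.im h0
    simp at h1
    linarith
  have hneR' : ∀ x : ℝ, (x : ℂ) - z ≠ 0 := by
    intro x h0
    have h1 := congrArg Complex.im h0
    simp at h1
    linarith
  have hI1 := integrable_boundary_div_sub hb0 hb1 hs hd.continuousOn hh hcz hlim
  have hI2 := integrable_boundary_div_sub hb0 hb1 hs hd.continuousOn hh hz'.ne' hlim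
  have hconjI : Integrable (fun x : ℝ => conj (κ x) / (x - z)) := by
    refine (Complex.conjLIE.toContinuousLinearEquiv.toContinuousLinearMap.integrable_comp
      hI1).congr (Eventually.of_forall fun x => ?_)
    simp
  -- The point conj z lies below the axis, so h(w)/(w - conj z) has no pole in ℍ. Conjugating the
  -- vanishing integral gives the claim.
  have E1 : ∫ x : ℝ, conj (κ x) / (x - z) = 0 := by
    have h1 := integral_boundary_div_sub_eq_zero (k := fun w => h w / (w - conj z)) hb0 hb1 hs hh
      hcz (hd.div (by fun_prop) hne) (fun w _ _ => rfl) hlim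
    have h2 := congrArg conj h1
    rw [← integral_conj] at h2
    simpa using h2
  -- The correction makes φ vanish at z without spoiling the growth bound. Cauchy's theorem then
  -- applies to φ(w)/(w - z), and the Poisson kernel integral evaluates the correction.
  set φ : ℂ → ℂ := fun w => h w - h z * (z - conj z) / (w - conj z) with hφdef
  have hφd : DifferentiableOn ℂ φ upperHalf := by
    refine hd.sub (DifferentiableOn.div (by fun_prop) (by fun_prop) hne)
  have hφz : φ z = 0 := by
    simp only [hφdef]
    rw [mul_div_cancel_right₀ _ (hne z hz), sub_self]
  have hφO : φ =O[𝓟 upperHalf] growthWeight b s := by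
    refine hh.sub ?_
    simp_rw [div_eq_mul_inv]
    exact (isBigO_inv_sub_conj_growthWeight hz' hs1).const_mul_left _
  have E2 : ∫ x : ℝ, (κ x - h z * (z - conj z) / (x - conj z)) / (x - z) = 0 := by
    refine integral_boundary_div_sub_eq_zero (k := dslope φ z) hb0 hb1 hs hφO hz'.ne' ?_ ?_ ?_
    · exact (Complex.differentiableOn_dslope (hopen.mem_nhds hz)).2 hφd
    · intro w _ hw
      rw [dslope_of_ne _ hw, slope_def_field, hφz, sub_zero]
    · filter_upwards [hlim] with x hx
      refine hx.sub (Tendsto.div tendsto_const_nhds ?_ (hneR x))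
      have : Continuous (fun y : ℝ => (x : ℂ) + y * Complex.I - conj z) := by fun_prop
      simpa using (this.tendsto 0).mono_left nhdsWithin_le_nhds
  have hker := integral_cauchy_kernel hz'
  have hkerI : Integrable (fun x : ℝ => (z - conj z) / (((x : ℂ) - conj z) * (x - z))) := by
    -- A non-integrable function has Bochner integral 0, but this integral is 2πi.
    by_contra hcon
    rw [integral_undef hcon] at hker
    have : (2 * Real.pi * Complex.I : ℂ) ≠ 0 := Complex.two_pi_I_ne_zero
    exact this hker.symm
  have E3 : ∫ x : ℝ, κ x / (x - z) = h z * (2 * Real.pi * Complex.I) := by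
    rw [← hker, ← integral_const_mul, ← sub_eq_zero, ← integral_sub hI2 (hkerI.const_mul _), ← E2]
    congr 1
    ext x
    have := hneR x
    have := hneR' x
    field_simp
  have hpt : ∀ x : ℝ, ((κ x).im : ℂ) / (x - z) =
      (2 * Complex.I)⁻¹ * (κ x / (x - z) - conj (κ x) / (x - z)) := by
    intro x
    rw [← sub_div, Complex.sub_conj]
    push_cast
    field_simp
  simp_rw [hpt]
  refine ⟨(hI2.sub hconjI).const_mul _, ?_⟩
  rw [integral_const_mul, integral_sub hI2 hconjI, E1, E3]
  have := Complex.I_ne_zero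
  field_simp
  simp

/-! ### The slit domain, Cauchy-type integrals on it, and inversion t ↦ 1/t -/

theorem mem_slitDomain_iff {z : ℂ} : z ∈ slitDomain ↔ z.re < 1 ∨ z.im ≠ 0 := by
  simp only [slitDomain, mem_compl_iff, mem_image, mem_Ici, not_exists, not_and]
  constructor
  · intro h
    by_contra! hc
    exact h z.re hc.1 (Complex.ext (by simp) (by simp [hc.2]))
  · rintro h x hx rfl
    simp at h
    linarith

theorem isOpen_slitDomain : IsOpen slitDomain := by
  have : slitDomain = {z : ℂ | z.re < 1} ∪ {z : ℂ | z.im ≠ 0} := by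
    ext z; exact mem_slitDomain_iff
  rw [this]
  exact (isOpen_lt Complex.continuous_re continuous_const).union
    (isOpen_ne_fun Complex.continuous_im continuous_const)

theorem zero_mem_slitDomain : (0 : ℂ) ∈ slitDomain := mem_slitDomain_iff.2 (by simp)

theorem ofReal_mem_slitDomain {x : ℝ} (hx : x < 1) : (x : ℂ) ∈ slitDomain :=
  mem_slitDomain_iff.2 (by simp [hx])

theorem upperHalf_subset_slitDomain : upperHalf ⊆ slitDomain := fun _ hz =>
  mem_slitDomain_iff.2 (Or.inr (ne_of_gt hz))

theorem isPreconnected_slitDomain : IsPreconnected slitDomain := by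
  have h : StarConvex ℝ (0 : ℂ) slitDomain := by
    rw [starConvex_zero_iff]
    intro z hz a ha0 ha1
    rw [mem_slitDomain_iff] at hz ⊢
    simp only [Complex.real_smul, Complex.re_ofReal_mul, Complex.im_ofReal_mul]
    rcases hz with hz | hz
    · left
      rcases le_or_gt z.re 0 with h0 | h0
      · nlinarith
      · nlinarith
    · rcases ha0.eq_or_lt with rfl | ha
      · left; simp
      · right; exact mul_ne_zero ha.ne' hz
  exact (h.isPathConnected zero_mem_slitDomain).isConnected.isPreconnected

theorem isOpen_upperHalf : IsOpen upperHalf := isOpen_lt continuous_const Complex.continuous_im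

/-- By compactness |1 - tz₀| has a positive minimum over [0, 1]. Moving z₀ by less than half of it
changes the quantity by less than half, so one c serves as radius and as bound. -/
theorem exists_le_norm_one_sub_mul {z₀ : ℂ} (hz₀ : z₀ ∈ slitDomain) :
    ∃ c : ℝ, 0 < c ∧ ∀ z ∈ Metric.ball z₀ c, ∀ t ∈ Icc (0 : ℝ) 1, c ≤ ‖1 - (t : ℂ) * z‖ := by
  have hc : ContinuousOn (fun t : ℝ => ‖1 - (t : ℂ) * z₀‖) (Icc 0 1) := by fun_prop
  obtain ⟨t₀, ht₀, hmin⟩ := isCompact_Icc.exists_isMinOn (nonempty_Icc.2 zero_le_one) hc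
  have hpos : 0 < ‖1 - (t₀ : ℂ) * z₀‖ := by
    rw [norm_pos_iff]
    intro h
    have hre := congrArg Complex.re h
    have him := congrArg Complex.im h
    simp at hre him
    rw [mem_slitDomain_iff] at hz₀
    have ht1 := ht₀.2
    have ht0 := ht₀.1
    rcases him with h0 | h0
    · rw [h0] at hre; norm_num at hre
    · rcases hz₀ with h1 | h1
      · rcases le_or_gt z₀.re 0 with h2 | h2 <;> nlinarith
      · exact h1 h0
  refine ⟨‖1 - (t₀ : ℂ) * z₀‖ / 2, by positivity, fun z hz t ht => ?_⟩
  have h1 : ‖1 - (t₀ : ℂ) * z₀‖ ≤ ‖1 - (t : ℂ) * z₀‖ := hmin ht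
  have h2 : ‖1 - (t : ℂ) * z₀‖ - ‖1 - (t : ℂ) * z‖ ≤ ‖(t : ℂ) * (z - z₀)‖ := by
    refine (norm_sub_norm_le _ _).trans (le_of_eq ?_)
    congr 1; ring
  have h3 : ‖(t : ℂ) * (z - z₀)‖ ≤ ‖z - z₀‖ := by
    rw [norm_mul, Complex.norm_of_nonneg ht.1]
    exact mul_le_of_le_one_left (norm_nonneg _) ht.2
  rw [mem_ball_iff_norm] at hz
  linarith

theorem integrableOn_div_one_sub_mul {d : ℝ → ℝ} (hd : IntegrableOn d (Ioo 0 1)) {z : ℂ}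
    (hz : z ∈ slitDomain) : IntegrableOn (fun t : ℝ => (d t : ℂ) / (1 - t * z)) (Ioo 0 1) := by
  obtain ⟨c, hc, hcz⟩ := exists_le_norm_one_sub_mul hz
  simp_rw [div_eq_mul_inv]
  refine Integrable.mul_bdd (c := c⁻¹) hd.ofReal
    (Measurable.aestronglyMeasurable (by fun_prop)) ?_
  filter_upwards [ae_restrict_mem measurableSet_Ioo] with t ht
  rw [norm_inv]
  exact inv_anti₀ hc (hcz z (Metric.mem_ball_self hc) t (Ioo_subset_Icc_self ht))

theorem differentiableOn_integral_div_one_sub_mul {d : ℝ → ℝ} (hd : IntegrableOn d (Ioo 0 1)) :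
    DifferentiableOn ℂ (fun z : ℂ => ∫ t in Ioo (0 : ℝ) 1, (d t : ℂ) / (1 - t * z)) slitDomain := by
  intro z₀ hz₀
  obtain ⟨c, hc, hcz⟩ := exists_le_norm_one_sub_mul hz₀
  have hdm : AEStronglyMeasurable (fun t : ℝ => (d t : ℂ)) (volume.restrict (Ioo 0 1)) :=
    hd.ofReal.aestronglyMeasurable
  have hm : ∀ z : ℂ, AEStronglyMeasurable (fun t : ℝ => (d t : ℂ) / (1 - t * z))
      (volume.restrict (Ioo 0 1)) := fun z => by
    simp_rw [div_eq_mul_inv]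
    exact hdm.mul (Measurable.aestronglyMeasurable (by fun_prop))
  have hmain := hasDerivAt_integral_of_dominated_loc_of_deriv_le (μ := volume.restrict (Ioo 0 1))
    (F := fun (z : ℂ) (t : ℝ) => (d t : ℂ) / (1 - t * z))
    (F' := fun (z : ℂ) (t : ℝ) => (d t : ℂ) * (t / (1 - t * z) ^ 2))
    (bound := fun t => |d t| * (c ^ 2)⁻¹) (Metric.ball_mem_nhds z₀ hc)
    (Eventually.of_forall hm) (integrableOn_div_one_sub_mul hd hz₀) ?_ ?_ (hd.abs.mul_const _) ?_
  · exact hmain.2.differentiableAt.differentiableWithinAt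
  · exact hdm.mul (Measurable.aestronglyMeasurable (by fun_prop))
  · filter_upwards [ae_restrict_mem measurableSet_Ioo] with t ht z hz
    have h1 := hcz z hz t (Ioo_subset_Icc_self ht)
    rw [norm_mul, norm_div, norm_pow, Complex.norm_of_nonneg ht.1.le, Complex.norm_real,
      Real.norm_eq_abs, div_eq_mul_inv]
    gcongr
    calc t * (‖1 - (t : ℂ) * z‖ ^ 2)⁻¹ ≤ 1 * (c ^ 2)⁻¹ := by
          gcongr
          exact ht.2.le
      _ = _ := one_mul _
  · filter_upwards [ae_restrict_mem measurableSet_Ioo] with t ht z hz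
    have h1 := hcz z hz t (Ioo_subset_Icc_self ht)
    have h2 : 1 - (t : ℂ) * z ≠ 0 := norm_pos_iff.1 (hc.trans_le h1)
    have h3 : HasDerivAt (fun z : ℂ => 1 - (t : ℂ) * z) (-(t : ℂ)) z := by
      simpa using ((hasDerivAt_id z).const_mul (t : ℂ)).const_sub 1
    have h4 := (h3.inv h2).const_mul (d t : ℂ)
    rw [neg_neg] at h4
    exact h4

theorem inv_image_Ioo_zero_one : (fun t : ℝ => t⁻¹) '' Ioo 0 1 = Ioi 1 := by
  ext x
  constructor
  · rintro ⟨t, ht, rfl⟩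
    exact (one_lt_inv₀ ht.1).2 ht.2
  · intro hx
    have hx0 : 0 < x := one_pos.trans hx
    exact ⟨x⁻¹, ⟨inv_pos.2 hx0, inv_lt_one_of_one_lt₀ hx⟩, inv_inv x⟩

theorem integral_Ioi_one_eq_integral_Ioo (g : ℝ → ℂ) :
    (IntegrableOn g (Ioi 1) ↔ IntegrableOn (fun t : ℝ => (t ^ 2)⁻¹ • g t⁻¹) (Ioo 0 1)) ∧
      ∫ x in Ioi (1 : ℝ), g x = ∫ t in Ioo (0 : ℝ) 1, (t ^ 2)⁻¹ • g t⁻¹ := by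
  have hder : ∀ t ∈ Ioo (0 : ℝ) 1,
      HasDerivWithinAt (fun t : ℝ => t⁻¹) (-(t ^ 2)⁻¹) (Ioo 0 1) t :=
    fun t ht => (hasDerivAt_inv ht.1.ne').hasDerivWithinAt
  have hinj : InjOn (fun t : ℝ => t⁻¹) (Ioo 0 1) := inv_injective.injOn
  have habs : ∀ t : ℝ, |-(t ^ 2)⁻¹| = (t ^ 2)⁻¹ := fun t => by
    rw [abs_neg, abs_of_nonneg (by positivity)]
  have h1 := integrableOn_image_iff_integrableOn_abs_deriv_smul measurableSet_Ioo hder hinj g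
  have h2 := integral_image_eq_integral_abs_deriv_smul measurableSet_Ioo hder hinj g
  simp only [habs, inv_image_Ioo_zero_one] at h1 h2
  exact ⟨h1, h2⟩

/-- The density `t ↦ Im G(1/t) / π`. -/
noncomputable def slitDensity (G : ℂ → ℂ) (t : ℝ) : ℝ := (G ((1 / t : ℝ) : ℂ)).im / Real.pi

/-! ### The integral formula for (F - 1)/z -/

section Representation

variable {F Fplus : ℂ → ℂ} {U : Set ℂ}

theorem dslope_zero_eq (hF0 : F 0 = 1) {w : ℂ} (hw : w ≠ 0) : dslope F 0 w = (F w - 1) / w := by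
  rw [dslope_of_ne _ hw, slope_def_field, hF0, sub_zero]

theorem ne_zero_of_mem_upperHalf {w : ℂ} (hw : w ∈ upperHalf) : w ≠ 0 := by
  rintro rfl
  exact lt_irrefl (0 : ℝ) hw

theorem differentiableOn_dslope_zero (hF : AnalyticOnNhd ℂ F slitDomain) :
    DifferentiableOn ℂ (dslope F 0) slitDomain :=
  (Complex.differentiableOn_dslope (isOpen_slitDomain.mem_nhds zero_mem_slitDomain)).2
    hF.differentiableOn

theorem isBigO_one_nhdsWithin_dslope
    (hF : AnalyticOnNhd ℂ F slitDomain) (hF0 : F 0 = 1)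
    (hSlit : ∀ x : ℝ, 1 < x → (x : ℂ) ∈ U) (hFplus : AnalyticOnNhd ℂ Fplus U)
    (hext : ∀ z ∈ upperHalf, Fplus z = F z) {p : ℂ} (hp : p ≠ 1) :
    dslope F 0 =O[𝓝[upperHalf] p] (fun _ => (1 : ℝ)) := by
  by_cases hps : p ∈ slitDomain
  · have hc : ContinuousAt (dslope F 0) p :=
      ((differentiableOn_dslope_zero hF).continuousOn).continuousAt
        (isOpen_slitDomain.mem_nhds hps)
    exact (hc.tendsto.isBigO_one ℝ).mono nhdsWithin_le_nhds
  · rw [mem_slitDomain_iff] at hps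
    push Not at hps
    obtain ⟨h1, h2⟩ := hps
    have hpr : p = (p.re : ℂ) := Complex.ext (by simp) (by simp [h2])
    have h3 : 1 < p.re := lt_of_le_of_ne h1 fun h => hp (by rw [hpr, ← h]; simp)
    have hp0 : p ≠ 0 := by
      rintro rfl
      simp at h3
      linarith
    have hpU : p ∈ U := by rw [hpr]; exact hSlit _ h3
    have hc : ContinuousAt (fun w => (Fplus w - 1) / w) p :=
      ((hFplus p hpU).continuousAt.sub continuousAt_const).div continuousAt_id hp0
    refine ((hc.tendsto.isBigO_one ℝ).mono nhdsWithin_le_nhds).congr' ?_ EventuallyEq.rfl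
    filter_upwards [self_mem_nhdsWithin] with w hw
    rw [dslope_zero_eq hF0 (ne_zero_of_mem_upperHalf hw), hext w hw]

theorem isBigO_dslope_at_one (hF0 : F 0 = 1)
    {α b : ℝ} (hαb : α ≤ b) (hb : 0 ≤ b)
    (h5 : F =O[𝓝[upperHalf] (1 : ℂ)] (fun z : ℂ => ‖z - 1‖ ^ (-α))) :
    dslope F 0 =O[𝓝[upperHalf] (1 : ℂ)] (fun z : ℂ => ‖z - 1‖ ^ (-b)) := by
  have hnear : ∀ᶠ w : ℂ in 𝓝[upperHalf] (1 : ℂ), 0 < ‖w - 1‖ ∧ ‖w - 1‖ ≤ 1 := by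
    filter_upwards [self_mem_nhdsWithin,
      mem_nhdsWithin_of_mem_nhds (Metric.closedBall_mem_nhds (1 : ℂ) one_pos)] with w hw hw1
    refine ⟨norm_pos_iff.2 (sub_ne_zero.2 ?_), mem_closedBall_iff_norm.1 hw1⟩
    rintro rfl
    have : (0 : ℝ) < (1 : ℂ).im := hw
    simp at this
  have hmono : ∀ a : ℝ, a ≤ b → (fun z : ℂ => ‖z - 1‖ ^ (-a)) =O[𝓝[upperHalf] (1 : ℂ)]
      (fun z : ℂ => ‖z - 1‖ ^ (-b)) := by
    intro a ha
    refine IsBigO.of_bound 1 ?_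
    filter_upwards [hnear] with w hw
    rw [Real.norm_of_nonneg (by positivity), Real.norm_of_nonneg (by positivity), one_mul]
    exact Real.rpow_le_rpow_of_exponent_ge hw.1 hw.2 (by linarith)
  have h1 : (fun _ : ℂ => (1 : ℂ)) =O[𝓝[upperHalf] (1 : ℂ)] (fun z : ℂ => ‖z - 1‖ ^ (-b)) := by
    refine IsBigO.trans (g := fun z : ℂ => ‖z - 1‖ ^ (-(0 : ℝ))) ?_ (hmono 0 hb)
    exact IsBigO.of_bound 1 (Eventually.of_forall fun w => by simp)
  have h2 : (fun w : ℂ => w⁻¹) =O[𝓝[upperHalf] (1 : ℂ)] (fun _ => (1 : ℝ)) :=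
    ((continuousAt_inv₀ one_ne_zero).tendsto.isBigO_one ℝ).mono nhdsWithin_le_nhds
  have h3 := ((h5.trans (hmono α hαb)).sub h1).mul h2
  simp only [mul_one] at h3
  refine h3.congr' ?_ EventuallyEq.rfl
  filter_upwards [self_mem_nhdsWithin] with w hw
  rw [dslope_zero_eq hF0 (ne_zero_of_mem_upperHalf hw), div_eq_mul_inv]

theorem isBigO_dslope_cobounded (hF0 : F 0 = 1)
    {α a : ℝ} (hαa : α ≤ a) (ha : 0 ≤ a)
    (h4 : F =O[Bornology.cobounded ℂ ⊓ 𝓟 upperHalf] (fun z : ℂ => ‖z‖ ^ α)) :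
    dslope F 0 =O[Bornology.cobounded ℂ ⊓ 𝓟 upperHalf] (fun z : ℂ => ‖z‖ ^ (-(1 - a))) := by
  have hfar : ∀ᶠ w : ℂ in Bornology.cobounded ℂ ⊓ 𝓟 upperHalf, 1 ≤ ‖w‖ :=
    Filter.Eventually.filter_mono inf_le_left
      (tendsto_norm_cobounded_atTop.eventually (eventually_ge_atTop 1))
  have hmono : ∀ c : ℝ, c ≤ a → (fun z : ℂ => ‖z‖ ^ c) =O[Bornology.cobounded ℂ ⊓ 𝓟 upperHalf]
      (fun z : ℂ => ‖z‖ ^ a) := by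
    intro c hc
    refine IsBigO.of_bound 1 ?_
    filter_upwards [hfar] with w hw
    rw [Real.norm_of_nonneg (by positivity), Real.norm_of_nonneg (by positivity), one_mul]
    exact Real.rpow_le_rpow_of_exponent_le hw hc
  have h1 : (fun _ : ℂ => (1 : ℂ)) =O[Bornology.cobounded ℂ ⊓ 𝓟 upperHalf]
      (fun z : ℂ => ‖z‖ ^ a) := by
    refine IsBigO.trans (g := fun z : ℂ => ‖z‖ ^ (0 : ℝ)) ?_ (hmono 0 ha)
    exact IsBigO.of_bound 1 (Eventually.of_forall fun w => by simp)
  have h2 : (fun w : ℂ => w⁻¹) =O[Bornology.cobounded ℂ ⊓ 𝓟 upperHalf] (fun w => ‖w‖⁻¹) :=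
    IsBigO.of_bound 1 (Eventually.of_forall fun w => by simp)
  refine (((h4.trans (hmono α hαa)).sub h1).mul h2).congr' ?_ ?_
  · filter_upwards [mem_inf_of_right (mem_principal_self upperHalf)] with w hw
    rw [dslope_zero_eq hF0 (ne_zero_of_mem_upperHalf hw), div_eq_mul_inv]
  · filter_upwards [hfar] with w hw
    rw [neg_sub, Real.rpow_sub (by linarith), Real.rpow_one, div_eq_mul_inv]

open Classical in
theorem tendsto_dslope_boundary
    (hF : AnalyticOnNhd ℂ F slitDomain) (hF0 : F 0 = 1)
    (hSlit : ∀ x : ℝ, 1 < x → (x : ℂ) ∈ U) (hFplus : AnalyticOnNhd ℂ Fplus U)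
    (hext : ∀ z ∈ upperHalf, Fplus z = F z) {x : ℝ} (hx : x ≠ 1) :
    Tendsto (fun y : ℝ => dslope F 0 (x + y * Complex.I)) (𝓝[>] 0)
      (𝓝 (if x < 1 then dslope F 0 x else (Fplus x - 1) / x)) := by
  have hline : Tendsto (fun y : ℝ => (x : ℂ) + y * Complex.I) (𝓝[>] 0) (𝓝 x) := by
    have : Continuous (fun y : ℝ => (x : ℂ) + y * Complex.I) := by fun_prop
    simpa using (this.tendsto 0).mono_left nhdsWithin_le_nhds
  split_ifs with h
  · have hc : ContinuousAt (dslope F 0) x :=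
      ((differentiableOn_dslope_zero hF).continuousOn).continuousAt
        (isOpen_slitDomain.mem_nhds (ofReal_mem_slitDomain h))
    exact hc.tendsto.comp hline
  · have h1 : 1 < x := lt_of_le_of_ne (not_lt.1 h) hx.symm
    have hx0 : (x : ℂ) ≠ 0 := by
      norm_cast
      linarith
    have hc : ContinuousAt (fun w => (Fplus w - 1) / w) x :=
      ((hFplus x (hSlit x h1)).continuousAt.sub continuousAt_const).div continuousAt_id hx0
    refine (hc.tendsto.comp hline).congr' ?_
    filter_upwards [self_mem_nhdsWithin] with y hy
    have hw : (x : ℂ) + y * Complex.I ∈ upperHalf := by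
      simpa [upperHalf] using hy
    rw [dslope_zero_eq hF0 (ne_zero_of_mem_upperHalf hw), Function.comp_apply, hext _ hw]

theorem im_dslope_ofReal (hF : AnalyticOnNhd ℂ F slitDomain) (hF0 : F 0 = 1)
    (h1 : ∀ x : ℝ, x < 1 → (F x).im = 0) {x : ℝ} (hx : x < 1) : (dslope F 0 x).im = 0 := by
  have hne : ∀ x : ℝ, x < 1 → x ≠ 0 → (dslope F 0 x).im = 0 := by
    intro x hx hx0
    rw [dslope_zero_eq hF0 (by exact_mod_cast hx0), Complex.div_ofReal_im]
    simp [h1 x hx]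
  by_cases hx0 : x = 0
  -- At 0 the slope is a derivative; its reality follows by continuity from negative x.
  · subst hx0
    have hc : ContinuousAt (dslope F 0) ((0 : ℝ) : ℂ) :=
      ((differentiableOn_dslope_zero hF).continuousOn).continuousAt
        (isOpen_slitDomain.mem_nhds (ofReal_mem_slitDomain hx))
    have hc2 : Tendsto (fun x : ℝ => (dslope F 0 x).im) (𝓝[<] 0) (𝓝 (dslope F 0 (0 : ℝ)).im) :=
      ((Complex.continuous_im.continuousAt.comp hc).comp
        (Complex.continuous_ofReal.continuousAt)).tendsto.mono_left nhdsWithin_le_nhds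
    refine tendsto_nhds_unique hc2 (tendsto_const_nhds.congr' ?_)
    filter_upwards [self_mem_nhdsWithin] with y hy
    have hy' : y < 0 := hy
    exact (hne y (by linarith) hy'.ne).symm
  · exact hne x hx hx0

theorem dslope_eq_integral_of_mem_upperHalf
    (hF : AnalyticOnNhd ℂ F slitDomain) (hF0 : F 0 = 1)
    (hSlit : ∀ x : ℝ, 1 < x → (x : ℂ) ∈ U) (hFplus : AnalyticOnNhd ℂ Fplus U)
    (hext : ∀ z ∈ upperHalf, Fplus z = F z)
    (h1 : ∀ x : ℝ, x < 1 → (F x).im = 0)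
    (h4 : ∃ α : ℝ, α < 1 ∧
      F =O[Bornology.cobounded ℂ ⊓ 𝓟 upperHalf] (fun z : ℂ => ‖z‖ ^ α))
    (h5 : ∃ α : ℝ, α < 1 ∧
      F =O[𝓝[upperHalf] (1 : ℂ)] (fun z : ℂ => ‖z - 1‖ ^ (-α))) {z : ℂ} (hz : z ∈ upperHalf) :
    IntegrableOn (fun t : ℝ => (slitDensity Fplus t : ℂ) / (1 - t * z)) (Ioo 0 1) ∧
      dslope F 0 z = ∫ t in Ioo (0 : ℝ) 1, (slitDensity Fplus t : ℂ) / (1 - t * z) := by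
  classical
  obtain ⟨α, hα, h4⟩ := h4
  obtain ⟨β, hβ, h5⟩ := h5
  -- The maxima weaken the given exponents so that the Schwarz formula applies: 0 < b < 1 and 0 < s
  -- ≤ 1.
  have hO : dslope F 0 =O[𝓟 upperHalf] growthWeight (max β (1 / 2)) (1 - max α 0) :=
    isBigO_growthWeight
      (fun p hp => isBigO_one_nhdsWithin_dslope hF hF0 hSlit hFplus hext hp)
      (isBigO_dslope_at_one hF0 (le_max_left _ _) (by positivity) h5)
      (isBigO_dslope_cobounded hF0 (le_max_left _ _) (le_max_right _ _) h4)
      (by simp [hα.le])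
  have hz' : 0 < z.im := hz
  obtain ⟨hI, hE⟩ := eq_integral_im_boundary (b := max β (1 / 2)) (s := 1 - max α 0)
    (lt_of_lt_of_le (by norm_num) (le_max_right _ _)) (max_lt hβ (by norm_num))
    (by simp [hα]) (by simp)
    ((differentiableOn_dslope_zero hF).mono upperHalf_subset_slitDomain) hO
    (κ := fun x => if x < 1 then dslope F 0 x else (Fplus x - 1) / x)
    (by
      filter_upwards [compl_mem_ae_iff.2 (measure_singleton (1 : ℝ))] with x hx
      exact tendsto_dslope_boundary hF hF0 hSlit hFplus hext hx) hz
  set κ : ℝ → ℂ := fun x => if x < 1 then dslope F 0 x else (Fplus x - 1) / x with hκ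
  have hκ1 : ∀ x : ℝ, x < 1 → (κ x).im = 0 := by
    intro x hx
    simp only [hκ, hx, if_true]
    exact im_dslope_ofReal hF hF0 h1 hx
  have hκ2 : ∀ x : ℝ, 1 < x → (κ x).im = (Fplus x).im / x := by
    intro x hx
    simp only [hκ, hx.not_gt, if_false]
    rw [Complex.div_ofReal_im]
    simp
  have hset : ∫ x : ℝ, ((κ x).im : ℂ) / (x - z) = ∫ x in Ioi (1 : ℝ), ((κ x).im : ℂ) / (x - z) := by
    -- The value of κ at 1 carries no meaning, but {1} is a null set.
    rw [← integral_Ici_eq_integral_Ioi]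
    refine (setIntegral_eq_integral_of_forall_compl_eq_zero fun x hx => ?_).symm
    rw [hκ1 x (not_le.1 hx)]
    simp
  have hcv := integral_Ioi_one_eq_integral_Ioo (fun x : ℝ => ((κ x).im : ℂ) / (x - z))
  have hpt : EqOn (fun t : ℝ => (t ^ 2)⁻¹ • (((κ t⁻¹).im : ℂ) / ((t⁻¹ : ℝ) - z)))
      (fun t : ℝ => (Real.pi : ℂ) * ((slitDensity Fplus t : ℂ) / (1 - t * z))) (Ioo 0 1) := by
    intro t ht
    have ht0 : (t : ℂ) ≠ 0 := by exact_mod_cast ht.1.ne'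
    have hpi : (Real.pi : ℂ) ≠ 0 := by exact_mod_cast Real.pi_ne_zero
    have hd1 : 1 - (t : ℂ) * z ≠ 0 := by
      intro h
      have := congrArg Complex.im h
      simp at this
      rcases this with h | h
      · exact ht.1.ne' h
      · exact hz'.ne' h
    have hd2 : (t : ℂ)⁻¹ - z = (1 - t * z) / t := by field_simp
    simp only
    rw [hκ2 _ ((one_lt_inv₀ ht.1).2 ht.2), slitDensity, one_div, Complex.real_smul]
    push_cast
    rw [hd2]
    field_simp
  have hpi : (Real.pi : ℂ) ≠ 0 := by exact_mod_cast Real.pi_ne_zero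
  constructor
  · have h2 := hcv.1.1 hI.integrableOn
    rw [integrableOn_congr_fun hpt measurableSet_Ioo] at h2
    refine (h2.const_mul (Real.pi : ℂ)⁻¹).congr (Eventually.of_forall fun t => ?_)
    simp only
    rw [inv_mul_cancel_left₀ hpi]
  · rw [hset, hcv.2, setIntegral_congr_fun measurableSet_Ioo hpt, integral_const_mul] at hE
    exact mul_left_cancel₀ hpi hE

/-- The representation at z = i suffices, since 1 - ti is bounded and never zero. -/
theorem integrableOn_slitDensity
    (h : IntegrableOn (fun t : ℝ => (slitDensity Fplus t : ℂ) / (1 - t * Complex.I)) (Ioo 0 1)) :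
    IntegrableOn (slitDensity Fplus) (Ioo 0 1) := by
  have h1 : IntegrableOn (fun t : ℝ => (slitDensity Fplus t : ℂ)) (Ioo 0 1) := by
    have h2 : IntegrableOn (fun t : ℝ => (slitDensity Fplus t : ℂ) / (1 - t * Complex.I) *
        (1 - t * Complex.I)) (Ioo 0 1) := by
      refine Integrable.mul_bdd (c := 2) h (Measurable.aestronglyMeasurable (by fun_prop)) ?_
      filter_upwards [ae_restrict_mem measurableSet_Ioo] with t ht
      refine (norm_sub_le _ _).trans ?_
      rw [norm_mul, Complex.norm_of_nonneg ht.1.le, Complex.norm_I, norm_one]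
      linarith [ht.2]
    refine h2.congr (Eventually.of_forall fun t => div_mul_cancel₀ _ ?_)
    intro h0
    have := congrArg Complex.re h0
    simp at this
  exact h1.re.congr (Eventually.of_forall fun t => by simp)

theorem eq_one_add_mul_integral
    (hF : AnalyticOnNhd ℂ F slitDomain) (hF0 : F 0 = 1)
    (hd : IntegrableOn (slitDensity Fplus) (Ioo 0 1))
    (hrep : ∀ z ∈ upperHalf, dslope F 0 z =
      ∫ t in Ioo (0 : ℝ) 1, (slitDensity Fplus t : ℂ) / (1 - t * z)) {z : ℂ}
    (hz : z ∈ slitDomain) :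
    F z = 1 + z * ∫ t in Ioo (0 : ℝ) 1, (slitDensity Fplus t : ℂ) / (1 - t * z) := by
  have hI : Complex.I ∈ upperHalf := by
    change 0 < Complex.I.im
    simp
  have h1 := ((differentiableOn_dslope_zero hF).analyticOnNhd
    isOpen_slitDomain).eqOn_of_preconnected_of_eventuallyEq
    ((differentiableOn_integral_div_one_sub_mul hd).analyticOnNhd isOpen_slitDomain)
    isPreconnected_slitDomain (upperHalf_subset_slitDomain hI)
    (by filter_upwards [isOpen_upperHalf.mem_nhds hI] with w hw using hrep w hw) hz
  simp only at h1
  rw [← h1]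
  by_cases hz0 : z = 0
  · simp [hz0, hF0]
  · rw [dslope_zero_eq hF0 hz0]
    field_simp
    ring

end Representation

/-! ### The representing measure, without mass at 1 -/

theorem slitMeasure_zero_right (α₀ : ℝ) (G : ℂ → ℂ) :
    slitMeasure α₀ 0 G = ENNReal.ofReal α₀ • Measure.dirac (0 : ℝ) +
      (volume.restrict (Ioo (0 : ℝ) 1)).withDensity
        (fun t => ENNReal.ofReal (slitDensity G t / t)) := by
  simp only [slitMeasure, ENNReal.ofReal_zero, zero_smul, add_zero, slitDensity, div_div]

theorem slitMeasure_zero_right_compl_Icc (α₀ : ℝ) (G : ℂ → ℂ) :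
    slitMeasure α₀ 0 G (Icc (0 : ℝ) 1)ᶜ = 0 := by
  rw [slitMeasure_zero_right, Measure.add_apply, Measure.smul_apply,
    Measure.dirac_apply' _ measurableSet_Icc.compl]
  have h : (volume.restrict (Ioo (0 : ℝ) 1)).withDensity
      (fun t => ENNReal.ofReal (slitDensity G t / t)) (Icc (0 : ℝ) 1)ᶜ = 0 := by
    refine withDensity_absolutelyContinuous _ _ ?_
    rw [Measure.restrict_apply measurableSet_Icc.compl]
    convert measure_empty (μ := (volume : Measure ℝ))
    ext x
    simp only [mem_inter_iff, mem_compl_iff, mem_empty_iff_false, iff_false, not_and]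
    exact fun h1 h2 => h1 (Ioo_subset_Icc_self h2)
  rw [h]
  simp

section Density

variable {α₀ : ℝ} {G : ℂ → ℂ}

theorem isProbabilityMeasure_slitMeasure (hα₀ : 0 ≤ α₀)
    (hρ : IntegrableOn (fun t => slitDensity G t / t) (Ioo 0 1))
    (hρ0 : ∀ t ∈ Ioo (0 : ℝ) 1, 0 ≤ slitDensity G t / t)
    (hsum : α₀ + ∫ t in Ioo (0 : ℝ) 1, slitDensity G t / t = 1) :
    IsProbabilityMeasure (slitMeasure α₀ 0 G) := by
  constructor
  rw [slitMeasure_zero_right, Measure.add_apply, Measure.smul_apply,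
    withDensity_apply _ MeasurableSet.univ, Measure.restrict_univ, measure_univ,
    ← ofReal_integral_eq_lintegral_ofReal hρ (by
      filter_upwards [ae_restrict_mem measurableSet_Ioo] with t ht using hρ0 t ht),
    smul_eq_mul, mul_one, ← ENNReal.ofReal_add hα₀ (setIntegral_nonneg measurableSet_Ioo hρ0), hsum,
    ENNReal.ofReal_one]

theorem setIntegral_slitMeasure (hα₀ : 0 ≤ α₀)
    (hρ : IntegrableOn (fun t => slitDensity G t / t) (Ioo 0 1))
    (hρ0 : ∀ t ∈ Ioo (0 : ℝ) 1, 0 ≤ slitDensity G t / t) {z : ℂ} (hz : z ∈ slitDomain) :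
    ∫ t in Icc (0 : ℝ) 1, 1 / (1 - (t : ℂ) * z) ∂(slitMeasure α₀ 0 G) =
      α₀ + ∫ t in Ioo (0 : ℝ) 1, ((slitDensity G t / t : ℝ) : ℂ) / (1 - t * z) := by
  have hr : (slitMeasure α₀ 0 G).restrict (Icc 0 1) = slitMeasure α₀ 0 G :=
    Measure.restrict_eq_self_of_ae_mem
      (mem_ae_iff.2 (slitMeasure_zero_right_compl_Icc α₀ G))
  have hm : AEMeasurable (fun t => ENNReal.ofReal (slitDensity G t / t))
      (volume.restrict (Ioo (0 : ℝ) 1)) := hρ.aestronglyMeasurable.aemeasurable.ennreal_ofReal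
  have hfin : ∀ᵐ t ∂(volume.restrict (Ioo (0 : ℝ) 1)),
      ENNReal.ofReal (slitDensity G t / t) < ⊤ := Eventually.of_forall fun _ => ENNReal.ofReal_lt_top
  have heq : (fun t : ℝ => (ENNReal.ofReal (slitDensity G t / t)).toReal •
        (1 / (1 - (t : ℂ) * z))) =ᵐ[volume.restrict (Ioo (0 : ℝ) 1)]
      fun t : ℝ => ((slitDensity G t / t : ℝ) : ℂ) / (1 - t * z) := by
    filter_upwards [ae_restrict_mem measurableSet_Ioo] with t ht
    rw [ENNReal.toReal_ofReal (hρ0 t ht), Complex.real_smul, mul_one_div]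
  have hd : Integrable (fun t : ℝ => 1 / (1 - (t : ℂ) * z))
      (ENNReal.ofReal α₀ • Measure.dirac (0 : ℝ)) :=
    (integrable_dirac (by simp)).smul_measure ENNReal.ofReal_ne_top
  have hw : Integrable (fun t : ℝ => 1 / (1 - (t : ℂ) * z))
      ((volume.restrict (Ioo (0 : ℝ) 1)).withDensity
        (fun t => ENNReal.ofReal (slitDensity G t / t))) := by
    rw [integrable_withDensity_iff_integrable_smul₀' hm hfin]
    exact (integrableOn_div_one_sub_mul hρ hz).congr heq.symm
  rw [hr, slitMeasure_zero_right, integral_add_measure hd hw, integral_smul_measure,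
    integral_dirac, integral_withDensity_eq_integral_toReal_smul₀ hm hfin, integral_congr_ae heq,
    ENNReal.toReal_ofReal hα₀]
  simp

theorem isRepresentingMeasure_slitMeasure {F : ℂ → ℂ} (hα₀ : 0 ≤ α₀)
    (hρ : IntegrableOn (fun t => slitDensity G t / t) (Ioo 0 1))
    (hρ0 : ∀ t ∈ Ioo (0 : ℝ) 1, 0 ≤ slitDensity G t / t)
    (hsum : α₀ + ∫ t in Ioo (0 : ℝ) 1, slitDensity G t / t = 1)
    (hF : ∀ z ∈ slitDomain,
      F z = α₀ + ∫ t in Ioo (0 : ℝ) 1, ((slitDensity G t / t : ℝ) : ℂ) / (1 - t * z)) :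
    IsRepresentingMeasure (slitMeasure α₀ 0 G) F where
  isProbabilityMeasure := isProbabilityMeasure_slitMeasure hα₀ hρ hρ0 hsum
  compl_Icc_eq_zero := slitMeasure_zero_right_compl_Icc α₀ G
  eq_integral z hz := by rw [hF z hz, setIntegral_slitMeasure hα₀ hρ hρ0 hz]

end Density

/-! ### Behaviour at 1 -/

theorem tendsto_one_sub_mul_nhdsLT_one {F : ℂ → ℂ} (hF : ContinuousOn F slitDomain)
    {α : ℝ} (hα : α < 1)
    (h5 : F =O[𝓝[upperHalf] (1 : ℂ)] (fun z : ℂ => ‖z - 1‖ ^ (-α))) :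
    Tendsto (fun x : ℝ => (1 - (x : ℂ)) * F x) (𝓝[<] (1 : ℝ)) (𝓝 0) := by
  obtain ⟨C, hC⟩ := h5.bound
  rw [eventually_nhdsWithin_iff, Metric.eventually_nhds_iff] at hC
  obtain ⟨ε, hε, hC⟩ := hC
  -- The bound holds only in ℍ; continuity of F on the slit domain carries it down to the real
  -- segment left of 1.
  have hbound : ∀ x : ℝ, x ∈ Ioo (1 - ε) 1 → ‖F x‖ ≤ C * (1 - x) ^ (-α) := by
    intro x hx
    have hline : Tendsto (fun y : ℝ => (x : ℂ) + y * Complex.I) (𝓝[>] 0) (𝓝 x) := by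
      have : Continuous (fun y : ℝ => (x : ℂ) + y * Complex.I) := by fun_prop
      simpa using (this.tendsto 0).mono_left nhdsWithin_le_nhds
    have h1 := (((hF.continuousAt (isOpen_slitDomain.mem_nhds
      (ofReal_mem_slitDomain hx.2))).tendsto).comp hline).norm
    have hx1 : ‖(x : ℂ) - 1‖ = 1 - x := by
      rw [← Complex.ofReal_one, ← Complex.ofReal_sub, Complex.norm_real, Real.norm_eq_abs,
        abs_sub_comm, abs_of_pos (by linarith [hx.2])]
    have hcw : ContinuousAt (fun w : ℂ => C * ‖‖w - 1‖ ^ (-α)‖) x := by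
      refine continuousAt_const.mul (ContinuousAt.norm ?_)
      refine ContinuousAt.rpow_const (by fun_prop) (Or.inl ?_)
      rw [hx1]; linarith [hx.2]
    have h2 := hcw.tendsto.comp hline
    have h3 : C * ‖‖(x : ℂ) - 1‖ ^ (-α)‖ = C * (1 - x) ^ (-α) := by
      rw [hx1, Real.norm_of_nonneg (Real.rpow_nonneg (by linarith [hx.2]) _)]
    rw [h3] at h2
    refine le_of_tendsto_of_tendsto h1 h2 ?_
    have hnear : Metric.ball (1 : ℂ) ε ∈ 𝓝 (x : ℂ) := by
      refine Metric.isOpen_ball.mem_nhds ?_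
      rw [mem_ball_iff_norm, hx1]
      linarith [hx.1]
    filter_upwards [hline.eventually hnear, self_mem_nhdsWithin] with y hy hy0
    refine hC hy ?_
    simpa [upperHalf] using hy0
  have hlim : Tendsto (fun x : ℝ => C * (1 - x) ^ (1 - α)) (𝓝[<] (1 : ℝ)) (𝓝 0) := by
    have hc : ContinuousAt (fun x : ℝ => C * (1 - x) ^ (1 - α)) 1 :=
      continuousAt_const.mul (ContinuousAt.rpow_const (by fun_prop) (Or.inr (by linarith)))
    have h0 : C * (1 - (1 : ℝ)) ^ (1 - α) = 0 := by
      rw [sub_self, Real.zero_rpow (by linarith), mul_zero]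
    have := hc.tendsto.mono_left (nhdsWithin_le_nhds (s := Iio 1))
    rwa [h0] at this
  refine squeeze_zero_norm' ?_ hlim
  filter_upwards [Ioo_mem_nhdsLT (show 1 - ε < 1 by linarith)] with x hx
  have hx0 : 0 < 1 - x := by linarith [hx.2]
  rw [norm_mul, ← Complex.ofReal_one, ← Complex.ofReal_sub, Complex.norm_of_nonneg hx0.le,
    Real.rpow_sub hx0, Real.rpow_one]
  calc (1 - x) * ‖F x‖ ≤ (1 - x) * (C * (1 - x) ^ (-α)) := by
        gcongr
        exact hbound x hx
    _ = C * ((1 - x) / (1 - x) ^ α) := by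
        rw [Real.rpow_neg hx0.le]; ring

/-! ### Behaviour at -∞ -/

section Limit

variable {d : ℝ → ℝ} {f : ℝ → ℝ}

theorem integrableOn_mul_div_one_sub_mul (hd : IntegrableOn d (Ioo 0 1)) {x : ℝ} (hx : x ≤ 0) :
    IntegrableOn (fun t => x * d t / (1 - t * x)) (Ioo 0 1) := by
  simp_rw [div_eq_mul_inv]
  refine Integrable.mul_bdd (c := 1) (hd.const_mul x)
    (Measurable.aestronglyMeasurable (by fun_prop)) ?_
  filter_upwards [ae_restrict_mem measurableSet_Ioo] with t ht
  have h1 : 1 ≤ 1 - t * x := by nlinarith [ht.1]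
  rw [norm_inv, Real.norm_of_nonneg (by linarith)]
  exact inv_le_one_of_one_le₀ h1

/-- For t in (0, 1) the function x/(1 - tx) increases on (-∞, 0], and d ≥ 0. -/
theorem monotoneOn_of_eq_one_add_integral (hd : IntegrableOn d (Ioo 0 1))
    (hd0 : ∀ t ∈ Ioo (0 : ℝ) 1, 0 ≤ d t)
    (hf : ∀ x ≤ 0, f x = 1 + ∫ t in Ioo (0 : ℝ) 1, x * d t / (1 - t * x)) :
    MonotoneOn f (Iic 0) := by
  intro x hx y hy hxy
  rw [hf x hx, hf y hy]
  refine add_le_add_right (setIntegral_mono_on (integrableOn_mul_div_one_sub_mul hd hx)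
    (integrableOn_mul_div_one_sub_mul hd hy) measurableSet_Ioo fun t ht => ?_) 1
  have hx' : x ≤ 0 := hx
  have hy' : y ≤ 0 := hy
  have h1 : 0 < 1 - t * x := by nlinarith [ht.1]
  have h2 : 0 < 1 - t * y := by nlinarith [ht.1]
  rw [div_le_div_iff₀ h1 h2]
  have := mul_le_mul_of_nonneg_left hxy (hd0 t ht)
  linarith

theorem nonneg_of_limsup_nonneg (hmono : MonotoneOn f (Iic 0))
    (hlim : (0 : EReal) ≤ limsup (fun x : ℝ => (f x : EReal)) atBot) {x : ℝ} (hx : x ≤ 0) :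
    0 ≤ f x := by
  by_contra! hneg
  have h1 : limsup (fun x : ℝ => (f x : EReal)) atBot ≤ (f x : EReal) := by
    refine limsup_le_of_le (by isBoundedDefault) ?_
    filter_upwards [eventually_le_atBot x] with y hy
    exact EReal.coe_le_coe_iff.2 (hmono (hy.trans hx) hx hy)
  have h2 := hlim.trans h1
  rw [← EReal.coe_zero, EReal.coe_le_coe_iff] at h2
  linarith

theorem tendsto_neg_mul_div_one_sub_mul {t : ℝ} (ht : 0 < t) (c : ℝ) :
    Tendsto (fun x : ℝ => x * c / (1 - t * x)) atBot (𝓝 (-(c / t))) := by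
  have h1 : Tendsto (fun x : ℝ => c / (x⁻¹ - t)) atBot (𝓝 (c / (0 - t))) :=
    tendsto_const_nhds.div (tendsto_inv_atBot_zero.sub_const t) (by linarith)
  rw [zero_sub, div_neg] at h1
  refine h1.congr' ?_
  filter_upwards [eventually_lt_atBot 0] with x hx
  have : x⁻¹ - t = (1 - t * x) / x := by
    have := hx.ne
    field_simp
  rw [this, div_div_eq_mul_div, mul_comm]

/-- Fatou's lemma along x = -n: the integrands nd(t)/(1 + tn) tend to d(t)/t, and f(-n) ≥ 0 bounds
their integrals by 1. -/
theorem integrableOn_div_of_nonneg (hd : IntegrableOn d (Ioo 0 1))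
    (hd0 : ∀ t ∈ Ioo (0 : ℝ) 1, 0 ≤ d t)
    (hf : ∀ x ≤ 0, f x = 1 + ∫ t in Ioo (0 : ℝ) 1, x * d t / (1 - t * x))
    (hf0 : ∀ x ≤ 0, 0 ≤ f x) : IntegrableOn (fun t => d t / t) (Ioo 0 1) := by
  have hm : AEStronglyMeasurable (fun t => d t / t) (volume.restrict (Ioo 0 1)) := by
    simp_rw [div_eq_mul_inv]
    exact hd.aestronglyMeasurable.mul (Measurable.aestronglyMeasurable (by fun_prop))
  have hnn : 0 ≤ᵐ[volume.restrict (Ioo 0 1)] fun t => d t / t := by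
    filter_upwards [ae_restrict_mem measurableSet_Ioo] with t ht
    exact div_nonneg (hd0 t ht) ht.1.le
  refine ⟨hm, ?_⟩
  rw [hasFiniteIntegral_iff_ofReal hnn]
  have hbd : ∀ n : ℕ, ∫⁻ t in Ioo (0 : ℝ) 1, ENNReal.ofReal (-(-(n : ℝ) * d t / (1 - t * -(n : ℝ))))
      ≤ 1 := by
    intro n
    have hn : -(n : ℝ) ≤ 0 := by simp
    have hI : IntegrableOn (fun t => -(-(n : ℝ) * d t / (1 - t * -(n : ℝ)))) (Ioo 0 1) :=
      (integrableOn_mul_div_one_sub_mul hd hn).neg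
    rw [← ofReal_integral_eq_lintegral_ofReal hI]
    · rw [ENNReal.ofReal_le_one]
      rw [integral_neg]
      linarith [hf _ hn, hf0 _ hn]
    · filter_upwards [ae_restrict_mem measurableSet_Ioo] with t ht
      simp only [Pi.zero_apply]
      rw [← neg_div, neg_mul, neg_neg]
      have h1 : 0 ≤ t * n := mul_nonneg ht.1.le (Nat.cast_nonneg n)
      exact div_nonneg (mul_nonneg (Nat.cast_nonneg n) (hd0 t ht)) (by linarith)
  have hlim : ∀ᵐ t ∂(volume.restrict (Ioo (0 : ℝ) 1)), ENNReal.ofReal (d t / t) =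
      liminf (fun n : ℕ => ENNReal.ofReal (-(-(n : ℝ) * d t / (1 - t * -(n : ℝ))))) atTop := by
    filter_upwards [ae_restrict_mem measurableSet_Ioo] with t ht
    have h1 := ((tendsto_neg_mul_div_one_sub_mul ht.1 (d t)).comp
      (tendsto_neg_atTop_atBot.comp tendsto_natCast_atTop_atTop)).neg
    rw [neg_neg] at h1
    exact (ENNReal.tendsto_ofReal h1).liminf_eq.symm
  rw [lintegral_congr_ae hlim]
  refine lt_of_le_of_lt (lintegral_liminf_le' fun n => ?_) ?_
  · exact (integrableOn_mul_div_one_sub_mul hd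
      (by simp)).aestronglyMeasurable.aemeasurable.neg.ennreal_ofReal
  · refine lt_of_le_of_lt (liminf_le_of_le (by isBoundedDefault) (a := 1) fun b hb => ?_)
      ENNReal.one_lt_top
    obtain ⟨n, hn⟩ := hb.exists
    exact hn.trans (hbd n)

theorem tendsto_atBot_one_sub_integral
    (hρ : IntegrableOn (fun t => d t / t) (Ioo 0 1)) (hd : IntegrableOn d (Ioo 0 1))
    (hd0 : ∀ t ∈ Ioo (0 : ℝ) 1, 0 ≤ d t)
    (hf : ∀ x ≤ 0, f x = 1 + ∫ t in Ioo (0 : ℝ) 1, x * d t / (1 - t * x)) :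
    Tendsto f atBot (𝓝 (1 - ∫ t in Ioo (0 : ℝ) 1, d t / t)) := by
  have h1 : Tendsto (fun x : ℝ => ∫ t in Ioo (0 : ℝ) 1, x * d t / (1 - t * x)) atBot
      (𝓝 (∫ t in Ioo (0 : ℝ) 1, -(d t / t))) := by
    refine tendsto_integral_filter_of_dominated_convergence (fun t => d t / t) ?_ ?_ hρ ?_
    · filter_upwards [eventually_le_atBot 0] with x hx
      exact (integrableOn_mul_div_one_sub_mul hd hx).aestronglyMeasurable
    · filter_upwards [eventually_le_atBot 0] with x hx
      filter_upwards [ae_restrict_mem measurableSet_Ioo] with t ht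
      have h2 : 0 < 1 - t * x := by nlinarith [ht.1]
      rw [norm_div, norm_mul, Real.norm_of_nonneg h2.le, Real.norm_of_nonneg (hd0 t ht),
        Real.norm_of_nonpos hx, div_le_div_iff₀ h2 ht.1]
      nlinarith [hd0 t ht]
    · filter_upwards [ae_restrict_mem measurableSet_Ioo] with t ht
      exact tendsto_neg_mul_div_one_sub_mul ht.1 _
  rw [integral_neg] at h1
  refine (h1.const_add 1).congr' ?_
  filter_upwards [eventually_le_atBot 0] with x hx
  rw [hf x hx]

end Limit

/-! ### Assembly -/

theorem theorem2p5 (F Fplus : ℂ → ℂ) (U : Set ℂ)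
    (hF : AnalyticOnNhd ℂ F slitDomain)
    (hF0 : F 0 = 1)
    -- `Fplus` is an analytic extension of `F` from the upper half-plane across `(1, +∞)`
    (hU : IsOpen U)
    (hUpper : upperHalf ⊆ U)
    (hSlit : ∀ x : ℝ, 1 < x → (x : ℂ) ∈ U)
    (hFplus : AnalyticOnNhd ℂ Fplus U)
    (hext : ∀ z ∈ upperHalf, Fplus z = F z)
    (h1 : ∀ x : ℝ, x < 1 → (F x).im = 0)
    (h2 : (0 : EReal) ≤ limsup (fun x : ℝ => ((F x).re : EReal)) atBot)
    (h3 : ∀ x : ℝ, 1 < x → 0 ≤ (Fplus x).im)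
    (h4 : ∃ α : ℝ, α < 1 ∧
      F =O[Bornology.cobounded ℂ ⊓ 𝓟 upperHalf] (fun z : ℂ => ‖z‖ ^ α))
    (h5 : ∃ α : ℝ, α < 1 ∧
      F =O[𝓝[upperHalf] (1 : ℂ)] (fun z : ℂ => ‖z - 1‖ ^ (-α))) :
    F ∈ classT ∧
    ∃ α₀ α₁ : ℝ, 0 ≤ α₀ ∧ 0 ≤ α₁ ∧
      Tendsto (fun x : ℝ => F x) atBot (𝓝 (α₀ : ℂ)) ∧
      Tendsto (fun x : ℝ => (1 - (x : ℂ)) * F x) (𝓝[<] (1 : ℝ)) (𝓝 (α₁ : ℂ)) ∧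
      IsRepresentingMeasure (slitMeasure α₀ α₁ Fplus) F := by
  set d := slitDensity Fplus with hd_def
  have hrep := fun z (hz : z ∈ upperHalf) =>
    dslope_eq_integral_of_mem_upperHalf hF hF0 hSlit hFplus hext h1 h4 h5 hz
  have hd : IntegrableOn d (Ioo 0 1) :=
    integrableOn_slitDensity (hrep Complex.I (by simp [upperHalf])).1
  have hd0 : ∀ t ∈ Ioo (0 : ℝ) 1, 0 ≤ d t := by
    intro t ht
    refine div_nonneg (h3 _ ?_) Real.pi_pos.le
    rw [one_div]
    exact (one_lt_inv₀ ht.1).2 ht.2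
  have hFz : ∀ z ∈ slitDomain, F z = 1 + z * ∫ t in Ioo (0 : ℝ) 1, (d t : ℂ) / (1 - t * z) :=
    fun z hz => eq_one_add_mul_integral hF hF0 hd (fun w hw => (hrep w hw).2) hz
  have hFreal : ∀ x ≤ (0 : ℝ),
      F x = ((1 + ∫ t in Ioo (0 : ℝ) 1, x * d t / (1 - t * x) : ℝ) : ℂ) := by
    intro x hx
    rw [hFz x (ofReal_mem_slitDomain (by linarith)), ← integral_const_mul]
    push_cast
    rw [← integral_complex_ofReal]
    congr 2
    ext t
    push_cast
    ring
  have hf : ∀ x ≤ (0 : ℝ), (F x).re = 1 + ∫ t in Ioo (0 : ℝ) 1, x * d t / (1 - t * x) := by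
    intro x hx
    rw [hFreal x hx, Complex.ofReal_re]
  have hmono := monotoneOn_of_eq_one_add_integral (f := fun x : ℝ => (F x).re) hd hd0 hf
  have hnn : ∀ x ≤ (0 : ℝ), 0 ≤ (F x).re := fun x hx => nonneg_of_limsup_nonneg hmono h2 hx
  have hρ := integrableOn_div_of_nonneg (f := fun x : ℝ => (F x).re) hd hd0 hf hnn
  have hlim := tendsto_atBot_one_sub_integral (f := fun x : ℝ => (F x).re) hρ hd hd0 hf
  set α₀ : ℝ := 1 - ∫ t in Ioo (0 : ℝ) 1, d t / t with hα₀_def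
  have hα₀ : 0 ≤ α₀ :=
    ge_of_tendsto hlim (by filter_upwards [eventually_le_atBot 0] with x hx using hnn x hx)
  have hFα : ∀ z ∈ slitDomain,
      F z = α₀ + ∫ t in Ioo (0 : ℝ) 1, ((d t / t : ℝ) : ℂ) / (1 - t * z) := by
    intro z hz
    have hI := integrableOn_div_one_sub_mul hρ hz
    have hρC : IntegrableOn (fun t : ℝ => ((d t / t : ℝ) : ℂ)) (Ioo 0 1) := hρ.ofReal
    have hα₀C : (α₀ : ℂ) = 1 - ∫ t in Ioo (0 : ℝ) 1, ((d t / t : ℝ) : ℂ) := by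
      rw [hα₀_def, integral_complex_ofReal]
      push_cast
      rfl
    -- This is zd/(1 - tz) = (d/t)/(1 - tz) - d/t under the integral; splitting it needs d/t
    -- integrable.
    rw [hFz z hz, ← integral_const_mul, hα₀C, sub_add_eq_add_sub, add_sub_assoc,
      ← integral_sub hI hρC]
    congr 1
    refine setIntegral_congr_fun measurableSet_Ioo fun t ht => ?_
    obtain ⟨c, hc, hcz⟩ := exists_le_norm_one_sub_mul hz
    have hne : 1 - (t : ℂ) * z ≠ 0 := norm_pos_iff.1 (hc.trans_le
      (hcz z (Metric.mem_ball_self hc) t (Ioo_subset_Icc_self ht)))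
    have ht0 : (t : ℂ) ≠ 0 := by exact_mod_cast ht.1.ne'
    push_cast
    rw [mul_div_assoc', div_sub' hne, div_eq_div_iff hne hne]
    field_simp
    ring
  have hmeas : IsRepresentingMeasure (slitMeasure α₀ 0 Fplus) F :=
    isRepresentingMeasure_slitMeasure hα₀ hρ (fun t ht => div_nonneg (hd0 t ht) ht.1.le)
      (sub_add_cancel _ _) hFα
  -- The mass at 1 is 0: condition 5 bounds (1 - x)F(x) by a multiple of (1 - x)^(1 - α) near 1,
  -- with α < 1.
  refine ⟨⟨hF, _, hmeas⟩, α₀, 0, hα₀, le_rfl, ?_, ?_, hmeas⟩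
  · refine ((Complex.continuous_ofReal.tendsto _).comp hlim).congr' ?_
    filter_upwards [eventually_lt_atBot 1] with x hx
    exact Complex.ext (by simp) (by simp [h1 x hx])
  · obtain ⟨α, hα, h5⟩ := h5
    simpa using tendsto_one_sub_mul_nhdsLT_one hF.continuousOn hα h5
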